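/- Let $d,N\ge 0$ be integers, let $\mathcal X\subset\mathbb R^d$ be compact, and for $i\in\{0,\dots,N\}$ let $k_i:\mathbb R^d\times\mathbb R^d\to\mathbb R$ be a measurable positive semidefinite kernel with $k_i(x,x)\le 1$ for $x\in\mathcal X$, and $\mathcal H_{k_i}$ its reproducing kernel Hilbert space. Let $g_0=f\in\mathcal H_{k_0}$ and $g_i\in\mathcal H_{k_i}$ with $\|g_i\|_{k_i}\le B_i$ for $0\le i\le N$, and suppose that the problem of minimizing $f(x)$ over $x\in\mathcal X$ subject to $g_i(x)\le 0$, $1\le i\le N$, has an optimal solution $x^*$; put $f^*=f(x^*)$. Let $\sigma\ge 0$, $\delta\in(0,1)$, let $T\ge 1$ be a horizon and let $1\le\lambda\le 1+2/T$. **Algorithm (CONFIG).** At step $t=1,\dots,T$ a point $x_t\in\mathcal X$ is sampled and $y_{i,t}=g_i(x_t)+\nu_{i,t}$, $0\le i\le N$, is observed. The noise is $\sigma$-sub-Gaussian, $\mathbb E\,e^{s\nu_{i,t}}\le e^{\sigma^2s^2/2}$ for all $s\in\mathbb R$, and for each $t$ the vector $(\nu_{i,t})_{0\le i\le N}$ is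 independent of $x_1,\dots,x_t$ and of the noise of the earlier steps (for instance, the $\nu_{i,t}$ are i.i.d. and $x_t$ is a measurable function of the earlier data). With $K_{i,t}=(k_i(x_a,x_b))_{a,b\le t}$, $k_i(x_{1:t},x)=(k_i(x_a,x))_{a\le t}$ and $y_{i,1:t}=(y_{i,a})_{a\le t}$ put $$\mu_{i,t}(x)=k_i(x_{1:t},x)^\top(K_{i,t}+\lambda I)^{-1}y_{i,1:t},\qquad \sigma_{i,t}^2(x)=k_i(x,x)-k_i(x_{1:t},x)^\top(K_{i,t}+\lambda I)^{-1}k_i(x_{1:t},x),$$ $$\gamma_{i,t}=\sup_{z_1,\dots,z_t\in\mathcal X}\tfrac12\log\det\bigl(I+\lambda^{-1}(k_i(z_a,z_b))_{a,b\le t}\bigr)\quad\text{(maximum information gain)},$$ $$\beta_{i,t}^{1/2}=B_i+\sigma\sqrt{2\bigl(\gamma_{i,t-1}+1+\ln((N+1)/\delta)\bigr)},\qquad l_{i,t}(x)=\mu_{i,t-1}(x)-\beta_{i,t}^{1/2}\sigma_{i,t-1}(x).$$ At step $t$ infeasibility is declared if for some $i\in\{1,\dots,N\}$ the function $l_{i,t}$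 is positive on all of $\mathcal X$; otherwise $x_t$ is a minimizer of $l_{0,t}$ over $\{x\in\mathcal X: l_{i,t}(x)\le 0,\ 1\le i\le N\}$. (Once this set is empty, the remaining points $x_t$ are arbitrary points of $\mathcal X$.) Let $R_t=\sum_{s=1}^t(f(x_s)-f^*)$, $R_t^+=\sum_{s=1}^t[f(x_s)-f^*]^+$ and $\mathcal V_{i,t}=\sum_{s=1}^t[g_i(x_s)]^+$. **Theorem.** With probability at least $1-\delta$, infeasibility is not declared in steps $1,\dots,T$, each $x_t$, $1\le t\le T$, solves its auxiliary problem, and for every $t\in\{1,\dots,T\}$ (in particular for $t=T$) $$R_t\le R_t^+\le 4\beta_{0,t}^{1/2}\sqrt{(t+2)\gamma_{0,t}},\qquad \mathcal V_{i,t}\le 4\beta_{i,t}^{1/2}\sqrt{(t+2)\gamma_{i,t}}\quad(1\le i\le N).$$ Moreover, for each $0\le i\le N$, $4\beta_{i,T}^{1/2}\sqrt{(T+2)\gamma_{i,T}}=\mathcal O(\gamma_{i,T}\sqrt T)$: there is a constant $C_i$, independent of $T$ and of $\lambda$, such that $4\beta_{i,T}^{1/2}\sqrt{(T+2)\gamma_{i,T}}\le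 C_i\,\gamma_{i,T}\sqrt T$ for all $T\ge1$ and all $\lambda\in[1,1+2/T]$. -/

import Mathlib

open MeasureTheory ProbabilityTheory
open scoped NNReal Matrix

namespace Config

noncomputable section

/-- The first `n` terms `u 1, …, u n` of a sequence whose steps are numbered from `1`. -/
def firstTerms {α : Type*} (n : ℕ) (u : ℕ → α) : Fin n → α := fun a => u (a + 1)

/-- The kernel matrix `K = (k (z a) (z b))` of a finite sequence of points. -/
def gram {E : Type*} (k : E → E → ℝ) {n : ℕ} (z : Fin n → E) : Matrix (Fin n) (Fin n) ℝ :=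
  Matrix.of fun a b => k (z a) (z b)

/-- The vector `[k (z 1) p, …, k (z n) p]`. -/
def kernelVec {E : Type*} (k : E → E → ℝ) {n : ℕ} (z : Fin n → E) (p : E) : Fin n → ℝ :=
  fun a => k (z a) p

/-- Posterior mean at `p` of the Gaussian process surrogate with kernel `k` and noise variance
`lam`, given the observations `y` at the points `z`. -/
def postMean {E : Type*} (k : E → E → ℝ) (lam : ℝ) {n : ℕ} (z : Fin n → E) (y : Fin n → ℝ)
    (p : E) : ℝ :=
  kernelVec k z p ⬝ᵥ ((gram k z + lam • (1 : Matrix (Fin n) (Fin n) ℝ))⁻¹ *ᵥ y)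

/-- Posterior covariance of the Gaussian process surrogate. -/
def postCov {E : Type*} (k : E → E → ℝ) (lam : ℝ) {n : ℕ} (z : Fin n → E) (p q : E) : ℝ :=
  k p q - kernelVec k z p ⬝ᵥ
    ((gram k z + lam • (1 : Matrix (Fin n) (Fin n) ℝ))⁻¹ *ᵥ kernelVec k z q)

/-- Posterior standard deviation of the Gaussian process surrogate. -/
def postStd {E : Type*} (k : E → E → ℝ) (lam : ℝ) {n : ℕ} (z : Fin n → E) (p : E) : ℝ :=
  √(postCov k lam z p p)

/-- Information gain `(1/2) log |I + lam⁻¹ K|` of a finite sequence of points. -/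
def infoGain {E : Type*} (k : E → E → ℝ) (lam : ℝ) {n : ℕ} (z : Fin n → E) : ℝ :=
  (1 / 2) * Real.log (1 + lam⁻¹ • gram k z).det

/-- Maximum information gain `γ n` over sequences of `n` points of `X` (repetitions allowed,
since the same point may be sampled several times). -/
def maxInfoGain {E : Type*} (X : Set E) (k : E → E → ℝ) (lam : ℝ) (n : ℕ) : ℝ :=
  ⨆ z : Fin n → X, infoGain k lam (fun a => (z a : E))

/-- The confidence width `β_t^{1/2} = B + σ √(2 (γ_{t-1} + 1 + ln ((N + 1) / δ)))` at a
step `t ≥ 1`, for a problem with `N` constraints. -/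
def betaSqrt {E : Type*} (N : ℕ) (X : Set E) (k : E → E → ℝ) (lam B σ δ : ℝ) (t : ℕ) : ℝ :=
  B + σ * √(2 * (maxInfoGain X k lam (t - 1) + 1 + Real.log (((N : ℝ) + 1) / δ)))

/-- The bound `4 β_T^{1/2} √((T + 2) γ_T)`. -/
def cumBound {E : Type*} (N : ℕ) (X : Set E) (k : E → E → ℝ) (lam B σ δ : ℝ) (T : ℕ) : ℝ :=
  4 * betaSqrt N X k lam B σ δ T * √(((T : ℝ) + 2) * maxInfoGain X k lam T)

/-- The lower confidence bound `l_t(p)` of step `t ≥ 1`, computed from the sampled points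
`x 1, …, x (t - 1)` and the corresponding observations `y 1, …, y (t - 1)`. -/
def lcb {E : Type*} (N : ℕ) (X : Set E) (k : E → E → ℝ) (lam B σ δ : ℝ)
    (x : ℕ → E) (y : ℕ → ℝ) (t : ℕ) (p : E) : ℝ :=
  postMean k lam (firstTerms (t - 1) x) (firstTerms (t - 1) y) p
    - betaSqrt N X k lam B σ δ t * postStd k lam (firstTerms (t - 1) x) p

/-- The points of `X` that satisfy the constraints `g i ≤ 0`, `i = 1, …, N`. The function `g 0`
is the objective and plays no role here. -/
def feasibleSet {E : Type*} {N : ℕ} (X : Set E) (g : Fin (N + 1) → E → ℝ) : Set E :=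
  {p | p ∈ X ∧ ∀ i : Fin N, g i.succ p ≤ 0}

/-- `p` is an optimal solution of: minimize `g 0` over `X` subject to `g i ≤ 0`,
`i = 1, …, N`. -/
def IsConstrainedMin {E : Type*} {N : ℕ} (X : Set E) (g : Fin (N + 1) → E → ℝ) (p : E) : Prop :=
  p ∈ feasibleSet X g ∧ ∀ q ∈ feasibleSet X g, g 0 p ≤ g 0 q

/-- The lower confidence bounds of all `N + 1` functions at step `t`; index `0` is the
objective. -/
def lcbs {E : Type*} {N : ℕ} (X : Set E) (k : Fin (N + 1) → E → E → ℝ) (lam : ℝ)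
    (B : Fin (N + 1) → ℝ) (σ δ : ℝ) (x : ℕ → E) (y : Fin (N + 1) → ℕ → ℝ) (t : ℕ) :
    Fin (N + 1) → E → ℝ :=
  fun i => lcb N X (k i) lam (B i) σ δ x (y i) t

/-- The test of the algorithm at a step with lower confidence bounds `l`: infeasibility is
declared if one of the lower confidence bounds of the constraints is positive on all of `X`. -/
def DeclaresInfeasible {E : Type*} {N : ℕ} (X : Set E) (l : Fin (N + 1) → E → ℝ) : Prop :=
  ∃ i : Fin N, ∀ p ∈ X, 0 < l i.succ p

/-- `x 1, …, x T` is a trajectory of the algorithm with observations `y`: as long as the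
auxiliary problems of all steps up to `t` are feasible, `x t` is an optimal solution of the
auxiliary problem of step `t`. Once an auxiliary problem is infeasible (in particular once
infeasibility is declared), the algorithm has no prescribed next sample, and the
remaining entries of the sequence are arbitrary points of `X`. -/
def IsTrajectory {E : Type*} {N : ℕ} (X : Set E) (k : Fin (N + 1) → E → E → ℝ) (lam : ℝ)
    (B : Fin (N + 1) → ℝ) (σ δ : ℝ) (T : ℕ) (x : ℕ → E) (y : Fin (N + 1) → ℕ → ℝ) : Prop :=
  ∀ t ∈ Finset.Icc 1 T, x t ∈ X ∧
    ((∀ s ∈ Finset.Icc 1 t, (feasibleSet X (lcbs X k lam B σ δ x y s)).Nonempty) →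
      IsConstrainedMin X (lcbs X k lam B σ δ x y t) (x t))

/-- A random run of the algorithm with horizon `T` for the functions `g 0` (objective) and
`g 1, …, g N` (constraints), with sampled points `x t` and noise `ν i t`, `1 ≤ t ≤ T`. -/
structure IsRun {E Ω : Type*} [MeasurableSpace E] [MeasurableSpace Ω] (μ : Measure Ω) {N : ℕ}
    (X : Set E) (k : Fin (N + 1) → E → E → ℝ) (lam : ℝ) (B : Fin (N + 1) → ℝ) (σ : ℝ≥0) (δ : ℝ)
    (g : Fin (N + 1) → E → ℝ) (T : ℕ) (x : ℕ → Ω → E) (ν : Fin (N + 1) → ℕ → Ω → ℝ) : Prop where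
  measurable_sample : ∀ t ∈ Finset.Icc 1 T, Measurable (x t)
  measurable_noise : ∀ i, ∀ t ∈ Finset.Icc 1 T, Measurable (ν i t)
  /-- The noise is `σ`-sub-Gaussian: `E[exp (s ν)] ≤ exp (σ² s² / 2)` for all real `s`. -/
  subgaussian : ∀ i, ∀ t ∈ Finset.Icc 1 T, HasSubgaussianMGF (ν i t) (σ ^ 2) μ
  /-- The noise of step `t` is independent of `x 1, …, x t` and of the noise of all earlier
  steps: noise is independent over time, and samples are chosen without knowledge of the present
  and future noise. -/
  indep : ∀ t ∈ Finset.Icc 1 T,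
    IndepFun
      (fun ω => (firstTerms t (fun s => x s ω), firstTerms (t - 1) (fun s i => ν i s ω)))
      (fun ω i => ν i t ω) μ
  /-- The samples are those of the algorithm fed with the observations `g i (x t) + ν i t`. -/
  trajectory : ∀ ω, IsTrajectory X k lam B σ δ T (fun t => x t ω)
    (fun i t => g i (x t ω) + ν i t ω)

/-- Cumulative regret `R_T` of the sequence `x 1, …, x T`, where `fstar` is the optimal value. -/
def cumRegret {E : Type*} (f : E → ℝ) (fstar : ℝ) (x : ℕ → E) (T : ℕ) : ℝ :=
  ∑ t ∈ Finset.Icc 1 T, (f (x t) - fstar)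

/-- Cumulative positive regret `R_T⁺`. -/
def cumPosRegret {E : Type*} (f : E → ℝ) (fstar : ℝ) (x : ℕ → E) (T : ℕ) : ℝ :=
  ∑ t ∈ Finset.Icc 1 T, max (f (x t) - fstar) 0

/-- Cumulative violation `V_T` of the constraint `g ≤ 0`. -/
def cumViolation {E : Type*} (g : E → ℝ) (x : ℕ → E) (T : ℕ) : ℝ :=
  ∑ t ∈ Finset.Icc 1 T, max (g (x t)) 0

end

end Config

/-! The argument is optimism under uncertainty. Suppose that every `g i` lies within `betaSqrt *
postStd` of its posterior mean at all steps. Then each lower confidence bound lies below its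
function, so `xstar` is feasible for every auxiliary problem and infeasibility is never declared.
The sample `x t` minimizes the lower bound of the objective and makes those of the constraints
nonpositive; since a function exceeds its lower bound by at most twice the width, both regret and
violation at step `t` are at most `2 * betaSqrt * postStd` at `x t`.

The widths are summed by the chain rule `infoGain_succ`: the information gain is the sum of `(1/2)
log (1 + v/lam)` over the successive posterior variances `v`. As `v ≤ 1 ≤ lam`, these logarithms
control the sum of the variances, and Cauchy-Schwarz turns this into `sum_width_le`.

For the band, the error splits into a bias, at most `‖g‖ * postStd` by Cauchy-Schwarz in the RKHS,
and the posterior mean of the noise, bounded through `selfNormSq` in `sq_postMean_le`. The process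
`mixture`, the exponential of `selfNormSq / 2 - infoGain`, starts at `1` and is a supermartingale:
each factor is a Gaussian mixture of the variables `exp (u W - u² / 2)`, whose means are at most `1`
by sub-Gaussianity. Ville's inequality at level `(N + 1) / δ` and a union bound over the `N + 1`
functions give probability `1 - δ`, uniformly over time. -/

namespace Config

/-! ### Kernel ridge regression through a feature map, and one-point update formulas -/

section Posterior

variable {E F : Type*} [NormedAddCommGroup F] [InnerProductSpace ℝ F] {k : E → E → ℝ} {φ : E → F}
  {lam : ℝ} {n : ℕ}

theorem gram_mulVec (hk : ∀ p q, k p q = inner ℝ (φ p) (φ q)) (z : Fin n → E) (a : Fin n → ℝ)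
    (b : Fin n) : (gram k z *ᵥ a) b = inner ℝ (φ (z b)) (∑ j, a j • φ (z j)) := by
  simp only [Matrix.mulVec, dotProduct, gram, Matrix.of_apply, hk, inner_sum, inner_smul_right]
  exact Finset.sum_congr rfl fun _ _ => mul_comm _ _

theorem dotProduct_gram_mulVec (hk : ∀ p q, k p q = inner ℝ (φ p) (φ q)) (z : Fin n → E)
    (a b : Fin n → ℝ) :
    a ⬝ᵥ (gram k z *ᵥ b) = inner ℝ (∑ j, a j • φ (z j)) (∑ j, b j • φ (z j)) := by
  simp only [dotProduct, gram_mulVec hk, sum_inner, real_inner_smul_left]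

theorem kernelVec_dotProduct (hk : ∀ p q, k p q = inner ℝ (φ p) (φ q)) (z : Fin n → E)
    (a : Fin n → ℝ) (p : E) :
    kernelVec k z p ⬝ᵥ a = inner ℝ (φ p) (∑ j, a j • φ (z j)) := by
  simp only [dotProduct, kernelVec, hk, inner_sum, inner_smul_right]
  exact Finset.sum_congr rfl fun _ _ => by rw [real_inner_comm, mul_comm]

theorem posDef_gram_add_smul_one (hk : ∀ p q, k p q = inner ℝ (φ p) (φ q)) (hlam : 0 < lam)
    (z : Fin n → E) : (gram k z + lam • (1 : Matrix (Fin n) (Fin n) ℝ)).PosDef := by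
  refine Matrix.PosDef.posSemidef_add ?_ (Matrix.PosDef.smul Matrix.PosDef.one hlam)
  refine Matrix.PosSemidef.of_dotProduct_mulVec_nonneg ?_ fun a => ?_
  · ext a b
    simp [gram, hk, real_inner_comm]
  · rw [star_trivial, dotProduct_gram_mulVec hk]
    exact real_inner_self_nonneg

theorem gram_add_mulVec_inv_mulVec (hk : ∀ p q, k p q = inner ℝ (φ p) (φ q)) (hlam : 0 < lam)
    (z : Fin n → E) (y : Fin n → ℝ) :
    (gram k z + lam • (1 : Matrix (Fin n) (Fin n) ℝ)) *ᵥ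
      ((gram k z + lam • (1 : Matrix (Fin n) (Fin n) ℝ))⁻¹ *ᵥ y) = y := by
  rw [Matrix.mulVec_mulVec, Matrix.mul_nonsing_inv _
    ((Matrix.isUnit_iff_isUnit_det _).1 (posDef_gram_add_smul_one hk hlam z).isUnit),
    Matrix.one_mulVec]

theorem inv_mulVec_eq_of_mulVec_eq (hk : ∀ p q, k p q = inner ℝ (φ p) (φ q)) (hlam : 0 < lam)
    (z : Fin n → E) {y u : Fin n → ℝ}
    (h : (gram k z + lam • (1 : Matrix (Fin n) (Fin n) ℝ)) *ᵥ u = y) :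
    (gram k z + lam • (1 : Matrix (Fin n) (Fin n) ℝ))⁻¹ *ᵥ y = u := by
  rw [← h, Matrix.mulVec_mulVec, Matrix.nonsing_inv_mul _
    ((Matrix.isUnit_iff_isUnit_det _).1 (posDef_gram_add_smul_one hk hlam z).isUnit),
    Matrix.one_mulVec]

theorem gram_mulVec_inv_mulVec (hk : ∀ p q, k p q = inner ℝ (φ p) (φ q)) (hlam : 0 < lam)
    (z : Fin n → E) (y : Fin n → ℝ) :
    gram k z *ᵥ ((gram k z + lam • (1 : Matrix (Fin n) (Fin n) ℝ))⁻¹ *ᵥ y) =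
      y - lam • ((gram k z + lam • (1 : Matrix (Fin n) (Fin n) ℝ))⁻¹ *ᵥ y) := by
  have h := gram_add_mulVec_inv_mulVec hk hlam z y
  rw [Matrix.add_mulVec, Matrix.smul_mulVec, Matrix.one_mulVec] at h
  exact eq_sub_of_add_eq h

theorem dotProduct_inv_mulVec_comm (hk : ∀ p q, k p q = inner ℝ (φ p) (φ q)) (hlam : 0 < lam)
    (z : Fin n → E) (u v : Fin n → ℝ) :
    u ⬝ᵥ ((gram k z + lam • (1 : Matrix (Fin n) (Fin n) ℝ))⁻¹ *ᵥ v) =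
      v ⬝ᵥ ((gram k z + lam • (1 : Matrix (Fin n) (Fin n) ℝ))⁻¹ *ᵥ u) := by
  have h : ((gram k z + lam • (1 : Matrix (Fin n) (Fin n) ℝ))⁻¹)ᵀ =
      (gram k z + lam • (1 : Matrix (Fin n) (Fin n) ℝ))⁻¹ := by
    have := (posDef_gram_add_smul_one hk hlam z).isHermitian.inv.eq
    rwa [Matrix.conjTranspose_eq_transpose_of_trivial] at this
  rw [Matrix.dotProduct_mulVec, ← Matrix.mulVec_transpose, h, dotProduct_comm]

/-- The posterior variance at `p` is the minimal value of the ridge regression problem of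
approximating `φ p` by the features of the sampled points. -/
theorem postCov_eq (hk : ∀ p q, k p q = inner ℝ (φ p) (φ q)) (hlam : 0 < lam)
    (z : Fin n → E) (p : E) {a : Fin n → ℝ}
    (ha : a = (gram k z + lam • (1 : Matrix (Fin n) (Fin n) ℝ))⁻¹ *ᵥ kernelVec k z p) :
    postCov k lam z p p = ‖φ p - ∑ j, a j • φ (z j)‖ ^ 2 + lam * (a ⬝ᵥ a) := by
  have h1 := dotProduct_gram_mulVec hk z a a
  have h2 := kernelVec_dotProduct hk z a p
  have h3 := gram_mulVec_inv_mulVec hk hlam z (kernelVec k z p)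
  rw [← ha] at h3
  rw [h3, dotProduct_sub, dotProduct_smul, dotProduct_comm, h2, smul_eq_mul] at h1
  rw [@norm_sub_sq_real, postCov, ← ha, h2, hk, real_inner_self_eq_norm_sq]
  rw [real_inner_self_eq_norm_sq] at h1
  linarith

theorem dotProduct_self_nonneg_real {ι : Type*} [Fintype ι] (a : ι → ℝ) : 0 ≤ a ⬝ᵥ a :=
  Finset.sum_nonneg fun _ _ => mul_self_nonneg _

theorem postCov_nonneg (hk : ∀ p q, k p q = inner ℝ (φ p) (φ q)) (hlam : 0 < lam)
    (z : Fin n → E) (p : E) : 0 ≤ postCov k lam z p p := by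
  rw [postCov_eq hk hlam z p rfl]
  have := dotProduct_self_nonneg_real
    ((gram k z + lam • (1 : Matrix (Fin n) (Fin n) ℝ))⁻¹ *ᵥ kernelVec k z p)
  positivity

theorem postCov_le (hk : ∀ p q, k p q = inner ℝ (φ p) (φ q)) (hlam : 0 < lam)
    (z : Fin n → E) (p : E) : postCov k lam z p p ≤ k p p := by
  have := (posDef_gram_add_smul_one hk hlam z).inv.posSemidef.dotProduct_mulVec_nonneg
    (kernelVec k z p)
  rw [star_trivial] at this
  rw [postCov]
  linarith

theorem postStd_nonneg (z : Fin n → E) (p : E) : 0 ≤ postStd k lam z p := Real.sqrt_nonneg _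

theorem sq_postStd (hk : ∀ p q, k p q = inner ℝ (φ p) (φ q)) (hlam : 0 < lam)
    (z : Fin n → E) (p : E) : postStd k lam z p ^ 2 = postCov k lam z p p :=
  Real.sq_sqrt (postCov_nonneg hk hlam z p)

/-- Ridge regression of noiseless values of a function of the RKHS. -/
theorem abs_sub_postMean_le (hk : ∀ p q, k p q = inner ℝ (φ p) (φ q)) (hlam : 0 < lam)
    (z : Fin n → E) (p : E) (g : F) :
    |inner ℝ (φ p) g - postMean k lam z (fun a => inner ℝ (φ (z a)) g) p| ≤
      ‖g‖ * postStd k lam z p := by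
  obtain ⟨a, ha⟩ : ∃ a, a = (gram k z + lam • (1 : Matrix (Fin n) (Fin n) ℝ))⁻¹ *ᵥ
    kernelVec k z p := ⟨_, rfl⟩
  have h1 : inner ℝ (φ p) g - postMean k lam z (fun a => inner ℝ (φ (z a)) g) p =
      inner ℝ (φ p - ∑ j, a j • φ (z j)) g := by
    rw [postMean, dotProduct_inv_mulVec_comm hk hlam, ← ha, inner_sub_left, sum_inner]
    simp [dotProduct, real_inner_smul_left, mul_comm]
  rw [h1, mul_comm]
  refine (abs_real_inner_le_norm _ _).trans
    (mul_le_mul_of_nonneg_right (Real.le_sqrt_of_sq_le ?_) (norm_nonneg _))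
  rw [postCov_eq hk hlam z p ha]
  have := mul_nonneg hlam.le (dotProduct_self_nonneg_real a)
  linarith

/-- The squared self-normalized size `eᵀ K (K + lam)⁻¹ e` of a noise vector `e`. -/
noncomputable def selfNormSq {E : Type*} (k : E → E → ℝ) (lam : ℝ) {n : ℕ} (z : Fin n → E)
    (e : Fin n → ℝ) : ℝ :=
  e ⬝ᵥ e - lam * (e ⬝ᵥ ((gram k z + lam • (1 : Matrix (Fin n) (Fin n) ℝ))⁻¹ *ᵥ e))

/-- Since `e = K u + lam u`, the quantity equals `e · K u = K u · K u + lam (u · K u)`, and `u · K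
u` is the squared norm of the feature combination. -/
theorem selfNormSq_eq (hk : ∀ p q, k p q = inner ℝ (φ p) (φ q)) (hlam : 0 < lam)
    (z : Fin n → E) (e : Fin n → ℝ) {u : Fin n → ℝ}
    (hu : u = (gram k z + lam • (1 : Matrix (Fin n) (Fin n) ℝ))⁻¹ *ᵥ e) :
    selfNormSq k lam z e =
      lam * ‖∑ j, u j • φ (z j)‖ ^ 2 + (gram k z *ᵥ u) ⬝ᵥ (gram k z *ᵥ u) := by
  have h1 := gram_mulVec_inv_mulVec hk hlam z e
  rw [← hu] at h1
  have h2 := dotProduct_gram_mulVec hk z u u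
  rw [real_inner_self_eq_norm_sq] at h2
  rw [← h2, h1, selfNormSq, ← hu]
  simp only [dotProduct_sub, sub_dotProduct, dotProduct_smul, smul_dotProduct, smul_eq_mul,
    dotProduct_comm u e]
  ring

/-- Cauchy-Schwarz in `F × ℝⁿ`: with `h` the ridge residual of `φ p`, `√lam` times the mean is the
inner product of `(h, √lam a)` and `(√lam w, v)`. Their squared norms are `postCov` and
`selfNormSq`. -/
theorem sq_postMean_le (hk : ∀ p q, k p q = inner ℝ (φ p) (φ q)) (hlam : 0 < lam)
    (z : Fin n → E) (e : Fin n → ℝ) (p : E) :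
    lam * postMean k lam z e p ^ 2 ≤ selfNormSq k lam z e * postCov k lam z p p := by
  obtain ⟨a, ha⟩ : ∃ a, a = (gram k z + lam • (1 : Matrix (Fin n) (Fin n) ℝ))⁻¹ *ᵥ
    kernelVec k z p := ⟨_, rfl⟩
  obtain ⟨u, hu⟩ : ∃ u, u = (gram k z + lam • (1 : Matrix (Fin n) (Fin n) ℝ))⁻¹ *ᵥ e := ⟨_, rfl⟩
  set w := ∑ j, u j • φ (z j) with hw
  set h := φ p - ∑ j, a j • φ (z j) with hh
  set v := gram k z *ᵥ u with hv
  have hm : postMean k lam z e p = inner ℝ (φ p) w := by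
    rw [postMean, ← hu, kernelVec_dotProduct hk]
  have h1 : inner ℝ (∑ j, a j • φ (z j)) w = a ⬝ᵥ v := (dotProduct_gram_mulVec hk z a u).symm
  have h2 : postMean k lam z e p = inner ℝ h w + a ⬝ᵥ v := by
    rw [hm, hh, inner_sub_left, h1]; ring
  have h3 : inner ℝ h w ^ 2 ≤ ‖h‖ ^ 2 * ‖w‖ ^ 2 := by
    rw [← mul_pow, ← sq_abs]
    exact pow_le_pow_left₀ (abs_nonneg _) (abs_real_inner_le_norm _ _) 2
  have h4 : (a ⬝ᵥ v) ^ 2 ≤ (a ⬝ᵥ a) * (v ⬝ᵥ v) := by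
    simpa [dotProduct, sq] using Finset.sum_mul_sq_le_sq_mul_sq Finset.univ a v
  have ha0 := dotProduct_self_nonneg_real a
  have hv0 := dotProduct_self_nonneg_real v
  rw [selfNormSq_eq hk hlam z e hu, postCov_eq hk hlam z p ha, h2]
  change _ ≤ (lam * ‖w‖ ^ 2 + v ⬝ᵥ v) * (‖h‖ ^ 2 + lam * (a ⬝ᵥ a))
  -- The cross term of the square, bounded by `4 P Q ≤ (P + Q)²` for the two mixed products `P`, `Q`
  -- on the right.
  have h5 : (2 * (inner ℝ h w * (a ⬝ᵥ v))) * lam ≤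
      lam ^ 2 * ‖w‖ ^ 2 * (a ⬝ᵥ a) + (v ⬝ᵥ v) * ‖h‖ ^ 2 := by
    have h6 : (inner ℝ h w * (a ⬝ᵥ v)) ^ 2 ≤
        (‖w‖ ^ 2 * (a ⬝ᵥ a)) * ((v ⬝ᵥ v) * ‖h‖ ^ 2) := by
      rw [mul_pow]
      calc _ ≤ (‖h‖ ^ 2 * ‖w‖ ^ 2) * ((a ⬝ᵥ a) * (v ⬝ᵥ v)) := by gcongr
        _ = _ := by ring
    have h7 : (lam * (inner ℝ h w * (a ⬝ᵥ v))) ^ 2 ≤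
        (lam ^ 2 * ‖w‖ ^ 2 * (a ⬝ᵥ a)) * ((v ⬝ᵥ v) * ‖h‖ ^ 2) := by
      calc _ = lam ^ 2 * (inner ℝ h w * (a ⬝ᵥ v)) ^ 2 := by ring
        _ ≤ lam ^ 2 * ((‖w‖ ^ 2 * (a ⬝ᵥ a)) * ((v ⬝ᵥ v) * ‖h‖ ^ 2)) := by gcongr
        _ = _ := by ring
    have h8 : (2 * (lam * (inner ℝ h w * (a ⬝ᵥ v)))) ^ 2 ≤
        (lam ^ 2 * ‖w‖ ^ 2 * (a ⬝ᵥ a) + (v ⬝ᵥ v) * ‖h‖ ^ 2) ^ 2 := by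
      nlinarith [sq_nonneg (lam ^ 2 * ‖w‖ ^ 2 * (a ⬝ᵥ a) - (v ⬝ᵥ v) * ‖h‖ ^ 2)]
    have h9 := abs_le_of_sq_le_sq h8 (by positivity)
    linarith [le_abs_self (2 * (lam * (inner ℝ h w * (a ⬝ᵥ v))))]
  have h10 := mul_le_mul_of_nonneg_left h3 hlam.le
  have h11 := mul_le_mul_of_nonneg_left h4 hlam.le
  linarith

/-- Block inversion with Schur complement `r = lam + postCov`: the new point contributes its squared
prediction error divided by its predictive variance. -/
theorem dotProduct_inv_mulVec_succ (hk : ∀ p q, k p q = inner ℝ (φ p) (φ q)) (hlam : 0 < lam)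
    (z : Fin (n + 1) → E) (y : Fin (n + 1) → ℝ) :
    y ⬝ᵥ ((gram k z + lam • (1 : Matrix (Fin (n + 1)) (Fin (n + 1)) ℝ))⁻¹ *ᵥ y) =
      (y ∘ Fin.castSucc) ⬝ᵥ ((gram k (z ∘ Fin.castSucc) +
        lam • (1 : Matrix (Fin n) (Fin n) ℝ))⁻¹ *ᵥ (y ∘ Fin.castSucc)) +
      (y (Fin.last n) - postMean k lam (z ∘ Fin.castSucc) (y ∘ Fin.castSucc) (z (Fin.last n))) ^ 2 /
        (lam + postCov k lam (z ∘ Fin.castSucc) (z (Fin.last n)) (z (Fin.last n))) := by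
  set z₀ := z ∘ Fin.castSucc with hz₀
  set y₀ := y ∘ Fin.castSucc with hy₀
  set p := z (Fin.last n) with hp
  set r := lam + postCov k lam z₀ p p with hr
  have hr0 : r ≠ 0 := by
    have := postCov_nonneg hk hlam z₀ p
    rw [hr]; positivity
  obtain ⟨a, ha⟩ : ∃ a, a = (gram k z₀ + lam • (1 : Matrix (Fin n) (Fin n) ℝ))⁻¹ *ᵥ
    kernelVec k z₀ p := ⟨_, rfl⟩
  obtain ⟨u, hu⟩ : ∃ u, u = (gram k z₀ + lam • (1 : Matrix (Fin n) (Fin n) ℝ))⁻¹ *ᵥ y₀ := ⟨_, rfl⟩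
  set s := (y (Fin.last n) - postMean k lam z₀ y₀ p) / r with hs
  have hm : postMean k lam z₀ y₀ p = kernelVec k z₀ p ⬝ᵥ u := by rw [postMean, hu]
  have hc : postCov k lam z₀ p p = k p p - kernelVec k z₀ p ⬝ᵥ a := by rw [postCov, ha]
  have ha1 := gram_add_mulVec_inv_mulVec hk hlam z₀ (kernelVec k z₀ p)
  have hu1 := gram_add_mulVec_inv_mulVec hk hlam z₀ y₀
  rw [← ha] at ha1
  rw [← hu] at hu1
  have hsr : s * r = y (Fin.last n) - postMean k lam z₀ y₀ p := div_mul_cancel₀ _ hr0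
  -- Block elimination suggests this solution of the bordered system, with `s` the prediction error
  -- divided by `r`; it is verified by substitution, last row separately.
  have key : (gram k z + lam • (1 : Matrix (Fin (n + 1)) (Fin (n + 1)) ℝ))⁻¹ *ᵥ y =
      Fin.snoc (α := fun _ => ℝ) (u - s • a) s := by
    refine inv_mulVec_eq_of_mulVec_eq hk hlam z ?_
    rw [Matrix.add_mulVec, Matrix.smul_mulVec, Matrix.one_mulVec]
    rw [Matrix.add_mulVec, Matrix.smul_mulVec, Matrix.one_mulVec] at ha1 hu1
    funext b
    refine Fin.lastCases ?_ (fun b => ?_) b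
    · have h1 : ∑ j : Fin n, k p (z j.castSucc) * (u j - s * a j) =
          kernelVec k z₀ p ⬝ᵥ (u - s • a) := by
        refine Finset.sum_congr rfl fun j _ => ?_
        simp [kernelVec, hk, real_inner_comm, hz₀]
      rw [dotProduct_sub, dotProduct_smul, smul_eq_mul] at h1
      simp [Matrix.mulVec, dotProduct, gram, Fin.sum_univ_castSucc]
      rw [← hp, h1]
      rw [hr, hc, hm] at hsr
      linarith
    · have h1 : ∑ j : Fin n, k (z b.castSucc) (z j.castSucc) * (u j - s * a j) =
          (gram k z₀ *ᵥ (u - s • a)) b := by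
        simp [Matrix.mulVec, dotProduct, gram, hz₀]
      rw [Matrix.mulVec_sub, Matrix.mulVec_smul] at h1
      simp [gram, Matrix.mulVec, dotProduct, Fin.sum_univ_castSucc]
      rw [← hp, h1]
      have h2 := congrFun ha1 b
      have h3 := congrFun hu1 b
      simp only [Pi.add_apply, Pi.smul_apply, smul_eq_mul] at h2 h3
      have h4 : kernelVec k z₀ p b = k (z b.castSucc) p := rfl
      have h5 : y₀ b = y b.castSucc := rfl
      rw [h4] at h2
      rw [h5] at h3
      simp only [Pi.sub_apply, Pi.smul_apply, smul_eq_mul]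
      linear_combination h3 - s * h2
  rw [key, ← hu]
  have h1 : y ⬝ᵥ (Fin.snoc (α := fun _ => ℝ) (u - s • a) s) =
      y₀ ⬝ᵥ (u - s • a) + y (Fin.last n) * s := by
    simp [dotProduct, Fin.sum_univ_castSucc, hy₀]
  have h2 : y₀ ⬝ᵥ a = postMean k lam z₀ y₀ p := by
    rw [ha, dotProduct_inv_mulVec_comm hk hlam, postMean]
  rw [h1, dotProduct_sub, dotProduct_smul, smul_eq_mul, h2, ← hsr, mul_pow]
  have h3 : s ^ 2 * r ^ 2 / r = s ^ 2 * r := by field_simp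
  rw [h3]
  linear_combination (-s) * hsr

/-- The increment has the form `w² - (w - m)² / (1 + v)` with `m` the posterior mean and `v =
postCov / lam`, which is the exponent produced by `lintegral_exp_mul_gaussianPDF`. -/
theorem selfNormSq_succ (hk : ∀ p q, k p q = inner ℝ (φ p) (φ q)) (hlam : 0 < lam)
    (z : Fin (n + 1) → E) (y : Fin (n + 1) → ℝ) :
    selfNormSq k lam z y = selfNormSq k lam (z ∘ Fin.castSucc) (y ∘ Fin.castSucc) +
      (y (Fin.last n) ^ 2 -
        (y (Fin.last n) - postMean k lam (z ∘ Fin.castSucc) (y ∘ Fin.castSucc)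
          (z (Fin.last n))) ^ 2 /
        (1 + postCov k lam (z ∘ Fin.castSucc) (z (Fin.last n)) (z (Fin.last n)) / lam)) := by
  have h0 := postCov_nonneg hk hlam (z ∘ Fin.castSucc) (z (Fin.last n))
  rw [selfNormSq, dotProduct_inv_mulVec_succ hk hlam, selfNormSq]
  have h1 : y ⬝ᵥ y = (y ∘ Fin.castSucc) ⬝ᵥ (y ∘ Fin.castSucc) + y (Fin.last n) ^ 2 := by
    simp [dotProduct, Fin.sum_univ_castSucc, sq]
  rw [h1]
  have h2 : lam + postCov k lam (z ∘ Fin.castSucc) (z (Fin.last n)) (z (Fin.last n)) ≠ 0 := by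
    positivity
  field_simp
  ring

theorem det_gram_succ (hk : ∀ p q, k p q = inner ℝ (φ p) (φ q)) (hlam : 0 < lam)
    (z : Fin (n + 1) → E) :
    (gram k z + lam • (1 : Matrix (Fin (n + 1)) (Fin (n + 1)) ℝ)).det =
      (gram k (z ∘ Fin.castSucc) + lam • (1 : Matrix (Fin n) (Fin n) ℝ)).det *
        (lam + postCov k lam (z ∘ Fin.castSucc) (z (Fin.last n)) (z (Fin.last n))) := by
  set z₀ := z ∘ Fin.castSucc with hz₀
  set p := z (Fin.last n) with hp
  have hA := (posDef_gram_add_smul_one hk hlam z₀).isUnit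
  set A := gram k z₀ + lam • (1 : Matrix (Fin n) (Fin n) ℝ) with hAdef
  let : Invertible A := hA.invertible
  have h : (gram k z + lam • (1 : Matrix (Fin (n + 1)) (Fin (n + 1)) ℝ)).submatrix
      finSumFinEquiv finSumFinEquiv =
      Matrix.fromBlocks A (Matrix.of fun b (_ : Fin 1) => kernelVec k z₀ p b)
        (Matrix.of fun (_ : Fin 1) b => kernelVec k z₀ p b)
        (Matrix.of fun (_ _ : Fin 1) => k p p + lam) := by
    ext a b
    rcases a with a | a <;> rcases b with b | b
    · simp [hAdef, gram, hz₀, Matrix.one_apply]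
      rfl
    · obtain rfl := Subsingleton.elim b 0
      have h1 : Fin.castAdd 1 a ≠ Fin.natAdd n (0 : Fin 1) := by
        intro h; have := congrArg Fin.val h; simp at this; omega
      simp [gram, kernelVec, h1]
      rfl
    · obtain rfl := Subsingleton.elim a 0
      have h1 : Fin.natAdd n (0 : Fin 1) ≠ Fin.castAdd 1 b := by
        intro h; have := congrArg Fin.val h; simp at this; omega
      simp [gram, kernelVec, h1, hk]
      exact real_inner_comm _ _
    · obtain rfl := Subsingleton.elim a 0
      obtain rfl := Subsingleton.elim b 0
      simp [gram]
      rfl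
  rw [← Matrix.det_submatrix_equiv_self finSumFinEquiv, h, Matrix.det_fromBlocks₁₁,
    Matrix.det_unique (n := Fin 1), Matrix.invOf_eq_nonsing_inv, Matrix.mul_assoc]
  have h2 : ((Matrix.of fun (_ : Fin 1) b => kernelVec k z₀ p b) *
      (A⁻¹ * (Matrix.of fun b (_ : Fin 1) => kernelVec k z₀ p b))) default default =
      kernelVec k z₀ p ⬝ᵥ (A⁻¹ *ᵥ kernelVec k z₀ p) := by
    simp [Matrix.mul_apply, dotProduct, Matrix.mulVec]
  rw [Matrix.sub_apply, h2, postCov]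
  simp only [Matrix.of_apply]
  ring

theorem infoGain_eq (hlam : 0 < lam) (z : Fin n → E) :
    infoGain k lam z = (1 / 2) * Real.log
      ((lam ^ n)⁻¹ * (gram k z + lam • (1 : Matrix (Fin n) (Fin n) ℝ)).det) := by
  have h : 1 + lam⁻¹ • gram k z = lam⁻¹ • (gram k z + lam • (1 : Matrix (Fin n) (Fin n) ℝ)) := by
    rw [smul_add, smul_smul, inv_mul_cancel₀ hlam.ne', one_smul, add_comm]
  rw [infoGain, h, Matrix.det_smul, Fintype.card_fin, inv_pow]

theorem infoGain_zero (z : Fin 0 → E) : infoGain k lam z = 0 := by simp [infoGain]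

theorem infoGain_succ (hk : ∀ p q, k p q = inner ℝ (φ p) (φ q)) (hlam : 0 < lam)
    (z : Fin (n + 1) → E) :
    infoGain k lam z = infoGain k lam (z ∘ Fin.castSucc) + (1 / 2) *
      Real.log (1 + postCov k lam (z ∘ Fin.castSucc) (z (Fin.last n)) (z (Fin.last n)) / lam) := by
  have h0 := postCov_nonneg hk hlam (z ∘ Fin.castSucc) (z (Fin.last n))
  have hd := (posDef_gram_add_smul_one hk hlam (z ∘ Fin.castSucc)).det_pos
  rw [infoGain_eq hlam, infoGain_eq hlam, ← mul_add, ← Real.log_mul (by positivity) (by positivity),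
    det_gram_succ hk hlam]
  congr 2
  field_simp
  ring

end Posterior

/-! ### Confidence bands, information gain and sums of widths -/

section Posterior

variable {E F : Type*} [NormedAddCommGroup F] [InnerProductSpace ℝ F] {k : E → E → ℝ} {φ : E → F}
  {lam : ℝ} {n : ℕ}

theorem postMean_add (z : Fin n → E) (u v : Fin n → ℝ) (p : E) :
    postMean k lam z (u + v) p = postMean k lam z u p + postMean k lam z v p := by
  simp [postMean, Matrix.mulVec_add, dotProduct_add]

theorem postMean_smul (z : Fin n → E) (c : ℝ) (u : Fin n → ℝ) (p : E) :
    postMean k lam z (c • u) p = c * postMean k lam z u p := by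
  simp [postMean, Matrix.mulVec_smul]

/-- The confidence band around the posterior mean, on the event that the noise is controlled in
self-normalized form. -/
theorem abs_sub_postMean_le_of_selfNormSq_le (hk : ∀ p q, k p q = inner ℝ (φ p) (φ q))
    (hlam : 1 ≤ lam) (z : Fin n → E) (p : E) (g : F) {B σ G L : ℝ} (hB : ‖g‖ ≤ B) (hσ : 0 ≤ σ)
    {y e : Fin n → ℝ} (hy : ∀ a, y a = inner ℝ (φ (z a)) g + σ * e a)
    (he : selfNormSq k lam z e / 2 - infoGain k lam z ≤ L) (hG : infoGain k lam z ≤ G) :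
    |inner ℝ (φ p) g - postMean k lam z y p| ≤
      (B + σ * √(2 * (G + 1 + L))) * postStd k lam z p := by
  have hlam0 : 0 < lam := by linarith
  have hy' : y = (fun a => inner ℝ (φ (z a)) g) + σ • e := by
    funext a; simp [hy]
  have h1 := abs_sub_postMean_le hk hlam0 z p g
  have h2 : |postMean k lam z e p| ≤ √(2 * (G + 1 + L)) * postStd k lam z p := by
    rw [postStd, ← Real.sqrt_mul' _ (postCov_nonneg hk hlam0 z p)]
    refine Real.abs_le_sqrt ?_
    have h3 := sq_postMean_le hk hlam0 z e p
    have h4 : postMean k lam z e p ^ 2 ≤ lam * postMean k lam z e p ^ 2 :=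
      le_mul_of_one_le_left (sq_nonneg _) hlam
    refine (h4.trans h3).trans ?_
    -- The hypotheses give `selfNormSq ≤ 2 (G + L)`; the `1` in the width is slack.
    exact mul_le_mul_of_nonneg_right (by linarith) (postCov_nonneg hk hlam0 z p)
  rw [hy', postMean_add, postMean_smul, ← sub_sub]
  have h5 := postStd_nonneg (k := k) (lam := lam) z p
  calc _ ≤ |inner ℝ (φ p) g - postMean k lam z (fun a => inner ℝ (φ (z a)) g) p| +
        |σ * postMean k lam z e p| := abs_sub _ _
    _ ≤ B * postStd k lam z p + σ * (√(2 * (G + 1 + L)) * postStd k lam z p) := by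
        rw [abs_mul, abs_of_nonneg hσ]
        gcongr
        exact h1.trans (by gcongr)
    _ = _ := by ring

theorem infoGain_nonneg (hk : ∀ p q, k p q = inner ℝ (φ p) (φ q)) (hlam : 0 < lam)
    (z : Fin n → E) : 0 ≤ infoGain k lam z := by
  induction n with
  | zero => rw [infoGain_zero]
  | succ n ih =>
    rw [infoGain_succ hk hlam]
    have h0 := postCov_nonneg hk hlam (z ∘ Fin.castSucc) (z (Fin.last n))
    have := Real.log_nonneg (le_add_of_nonneg_right (div_nonneg h0 hlam.le) : (1 : ℝ) ≤ _)
    have := ih (z ∘ Fin.castSucc)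
    positivity

theorem infoGain_le (hk : ∀ p q, k p q = inner ℝ (φ p) (φ q)) (hlam : 0 < lam) {c : ℝ}
    (z : Fin n → E) (hz : ∀ a, k (z a) (z a) ≤ c) :
    infoGain k lam z ≤ n * ((1 / 2) * Real.log (1 + c / lam)) := by
  induction n with
  | zero => simp [infoGain_zero]
  | succ n ih =>
    rw [infoGain_succ hk hlam]
    have h0 := postCov_nonneg hk hlam (z ∘ Fin.castSucc) (z (Fin.last n))
    have h1 := (postCov_le hk hlam (z ∘ Fin.castSucc) (z (Fin.last n))).trans (hz (Fin.last n))
    have h2 : Real.log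
        (1 + postCov k lam (z ∘ Fin.castSucc) (z (Fin.last n)) (z (Fin.last n)) / lam) ≤
        Real.log (1 + c / lam) := Real.log_le_log (by positivity) (by gcongr)
    have := ih (z ∘ Fin.castSucc) fun a => hz _
    push_cast
    linarith

variable {X : Set E}

/-- A real supremum over an unbounded family is `0` by convention, so boundedness is what makes
`maxInfoGain` dominate the individual gains. -/
theorem bddAbove_infoGain (hk : ∀ p q, k p q = inner ℝ (φ p) (φ q)) (hlam : 0 < lam) {c : ℝ}
    (hc : ∀ p ∈ X, k p p ≤ c) (n : ℕ) :
    BddAbove (Set.range fun z : Fin n → X => infoGain k lam fun a => (z a : E)) := by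
  refine ⟨n * ((1 / 2) * Real.log (1 + c / lam)), ?_⟩
  rintro _ ⟨z, rfl⟩
  exact infoGain_le hk hlam _ fun a => hc _ (z a).2

theorem infoGain_le_maxInfoGain (hk : ∀ p q, k p q = inner ℝ (φ p) (φ q)) (hlam : 0 < lam) {c : ℝ}
    (hc : ∀ p ∈ X, k p p ≤ c) (z : Fin n → E) (hz : ∀ a, z a ∈ X) :
    infoGain k lam z ≤ maxInfoGain X k lam n :=
  le_ciSup (bddAbove_infoGain hk hlam hc n) fun a => (⟨z a, hz a⟩ : X)

theorem maxInfoGain_nonneg (hk : ∀ p q, k p q = inner ℝ (φ p) (φ q)) (hlam : 0 < lam) (n : ℕ) :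
    0 ≤ maxInfoGain X k lam n :=
  Real.iSup_nonneg fun _ => infoGain_nonneg hk hlam _

/-- Appending any point of `X` adds a nonnegative term in the chain rule. -/
theorem maxInfoGain_mono (hk : ∀ p q, k p q = inner ℝ (φ p) (φ q)) (hlam : 0 < lam) {c : ℝ}
    (hc : ∀ p ∈ X, k p p ≤ c) (hX : X.Nonempty) : Monotone (maxInfoGain X k lam) := by
  obtain ⟨p, hp⟩ := hX
  have : Nonempty X := ⟨⟨p, hp⟩⟩
  refine monotone_nat_of_le_succ fun n => ciSup_le fun z => ?_
  have h1 := infoGain_le_maxInfoGain hk hlam hc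
    (Fin.snoc (α := fun _ => E) (fun a => (z a : E)) p) (fun a => by
      refine Fin.lastCases ?_ (fun b => ?_) a
      · simpa using hp
      · simp)
  refine le_trans ?_ h1
  rw [infoGain_succ hk hlam]
  have h2 : (Fin.snoc (α := fun _ => E) (fun a => (z a : E)) p) ∘ Fin.castSucc =
      fun a => (z a : E) := by
    funext a; simp
  rw [h2]
  refine le_add_of_nonneg_right (mul_nonneg (by norm_num) (Real.log_nonneg ?_))
  exact le_add_of_nonneg_right (div_nonneg (postCov_nonneg hk hlam _ _) hlam.le)

theorem betaSqrt_mono (hk : ∀ p q, k p q = inner ℝ (φ p) (φ q)) (hlam : 0 < lam) {c : ℝ}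
    (hc : ∀ p ∈ X, k p p ≤ c) (hX : X.Nonempty) (N : ℕ) (B : ℝ) {σ : ℝ} (hσ : 0 ≤ σ) (δ : ℝ) :
    Monotone (betaSqrt N X k lam B σ δ) := by
  intro s t hst
  have := maxInfoGain_mono hk hlam hc hX (Nat.sub_le_sub_right hst 1)
  unfold betaSqrt
  gcongr

theorem betaSqrt_nonneg (N : ℕ) {B σ : ℝ} (hB : 0 ≤ B) (hσ : 0 ≤ σ) (δ : ℝ) (t : ℕ) :
    0 ≤ betaSqrt N X k lam B σ δ t :=
  add_nonneg hB (mul_nonneg hσ (Real.sqrt_nonneg _))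

/-- Termwise, `log (1 + v/lam) ≥ v / (lam + v) ≥ v / (2 lam)` because `v ≤ 1 ≤ lam`; the chain rule
carries a factor `1/2`, hence the constant `4 lam`. -/
theorem sum_postCov_le (hk : ∀ p q, k p q = inner ℝ (φ p) (φ q)) (hlam : 1 ≤ lam) (x : ℕ → E)
    (t : ℕ) (hx : ∀ s ∈ Finset.Icc 1 t, k (x s) (x s) ≤ 1) :
    ∑ s ∈ Finset.Icc 1 t, postCov k lam (firstTerms (s - 1) x) (x s) (x s) ≤
      4 * lam * infoGain k lam (firstTerms t x) := by
  have hlam0 : 0 < lam := by linarith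
  induction t with
  | zero => simp [infoGain_zero]
  | succ t ih =>
    rw [Finset.sum_Icc_succ_top (by omega), infoGain_succ hk hlam0]
    change _ ≤ 4 * lam * (infoGain k lam (firstTerms t x) + 1 / 2 * Real.log
      (1 + postCov k lam (firstTerms t x) (x (t + 1)) (x (t + 1)) / lam))
    have h1 := ih fun s hs => hx s (Finset.Icc_subset_Icc_right (by omega) hs)
    rw [Nat.add_sub_cancel]
    have h0 := postCov_nonneg hk hlam0 (firstTerms t x) (x (t + 1))
    have h2 := (postCov_le hk hlam0 (firstTerms t x) (x (t + 1))).trans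
      (hx (t + 1) (by simp))
    set v := postCov k lam (firstTerms t x) (x (t + 1)) (x (t + 1)) with hv
    have h3 := Real.one_sub_inv_le_log_of_pos (show 0 < 1 + v / lam by positivity)
    have h4 : v / 2 ≤ lam * (1 - (1 + v / lam)⁻¹) := by
      have : lam * (1 - (1 + v / lam)⁻¹) = lam * v / (lam + v) := by
        field_simp
        ring
      rw [this, div_le_div_iff₀ (by norm_num) (by positivity)]
      nlinarith
    have h5 := mul_le_mul_of_nonneg_left h3 hlam0.le
    linarith

/-- The sum of the confidence widths at the sampled points. -/
theorem sum_width_le (hk : ∀ p q, k p q = inner ℝ (φ p) (φ q)) (hlam : 1 ≤ lam)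
    (hc : ∀ p ∈ X, k p p ≤ 1) (hX : X.Nonempty) (N : ℕ) {B σ : ℝ} (hB : 0 ≤ B) (hσ : 0 ≤ σ) (δ : ℝ)
    (x : ℕ → E) {t : ℕ} (hx : ∀ s ∈ Finset.Icc 1 t, x s ∈ X) (hlt : lam * t ≤ t + 2) :
    ∑ s ∈ Finset.Icc 1 t,
      2 * (betaSqrt N X k lam B σ δ s * postStd k lam (firstTerms (s - 1) x) (x s)) ≤
      cumBound N X k lam B σ δ t := by
  have hlam0 : 0 < lam := by linarith
  -- Cauchy-Schwarz gives `t * 4 lam γ`; the hypothesis `lam * t ≤ t + 2` produces the factor `t +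
  -- 2`.
  have h1 : (∑ s ∈ Finset.Icc 1 t, postStd k lam (firstTerms (s - 1) x) (x s)) ^ 2 ≤
      4 * ((t + 2) * maxInfoGain X k lam t) := by
    have h2 := sq_sum_le_card_mul_sum_sq (s := Finset.Icc 1 t)
      (f := fun s => postStd k lam (firstTerms (s - 1) x) (x s))
    simp only [sq_postStd hk hlam0, Nat.card_Icc, Nat.add_sub_cancel] at h2
    have h3 := sum_postCov_le hk hlam x t fun s hs => hc _ (hx s hs)
    have h4 := infoGain_le_maxInfoGain hk hlam0 hc (firstTerms t x)
      (fun a => hx _ (by simp))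
    have h5 := maxInfoGain_nonneg (X := X) hk hlam0 t
    calc _ ≤ _ := h2
      _ ≤ t * (4 * lam * maxInfoGain X k lam t) := by gcongr; exact h3.trans (by gcongr)
      _ = 4 * ((lam * t) * maxInfoGain X k lam t) := by ring
      _ ≤ _ := by gcongr
  have h2 : ∑ s ∈ Finset.Icc 1 t, postStd k lam (firstTerms (s - 1) x) (x s) ≤
      2 * √((t + 2) * maxInfoGain X k lam t) := by
    refine (Real.le_sqrt_of_sq_le h1).trans_eq ?_
    rw [Real.sqrt_mul (by norm_num), show (4 : ℝ) = 2 ^ 2 by norm_num,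
      Real.sqrt_sq (by norm_num)]
  calc _ ≤ ∑ s ∈ Finset.Icc 1 t,
      2 * (betaSqrt N X k lam B σ δ t * postStd k lam (firstTerms (s - 1) x) (x s)) := by
        refine Finset.sum_le_sum fun s hs => ?_
        have := betaSqrt_mono hk hlam0 hc hX N B hσ δ (Finset.mem_Icc.1 hs).2
        have := postStd_nonneg (k := k) (lam := lam) (firstTerms (s - 1) x) (x s)
        gcongr
    _ = 2 * betaSqrt N X k lam B σ δ t *
        ∑ s ∈ Finset.Icc 1 t, postStd k lam (firstTerms (s - 1) x) (x s) := by
        rw [Finset.mul_sum]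
        exact Finset.sum_congr rfl fun _ _ => by ring
    _ ≤ 2 * betaSqrt N X k lam B σ δ t * (2 * √((t + 2) * maxInfoGain X k lam t)) := by
        have := betaSqrt_nonneg (X := X) (k := k) (lam := lam) N hB hσ δ t
        gcongr
    _ = _ := by rw [cumBound]; ring

/-- The cumulative bounds are of order `γ_T √T`, uniformly in `T` and `lam`. -/
theorem exists_cumBound_le (hk : ∀ p q, k p q = inner ℝ (φ p) (φ q))
    (hc : ∀ p ∈ X, k p p ≤ 1) (hX : X.Nonempty) (N : ℕ) {B σ : ℝ} (hB : 0 ≤ B) (hσ : 0 ≤ σ) {δ : ℝ}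
    (hδ : 0 < δ) (hδ' : δ < 1) :
    ∃ C : ℝ, ∀ T : ℕ, 1 ≤ T → ∀ lam : ℝ, 1 ≤ lam → lam ≤ 1 + 2 / (T : ℝ) →
      cumBound N X k lam B σ δ T ≤ C * (maxInfoGain X k lam T * √(T : ℝ)) := by
  -- If the kernel vanishes on the diagonal of `X`, the information gain and hence both sides are
  -- `0`. Otherwise `γ` is bounded below by a positive constant, which absorbs the terms of
  -- `betaSqrt` that do not grow with `γ`.
  by_cases h0 : ∀ p ∈ X, k p p ≤ 0
  · refine ⟨0, fun T hT lam hlam _ => ?_⟩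
    have hlam0 : 0 < lam := by linarith
    have h1 : maxInfoGain X k lam T = 0 := by
      refine le_antisymm (Real.iSup_le (fun z => ?_) le_rfl) (maxInfoGain_nonneg hk hlam0 T)
      have := infoGain_le hk hlam0 (fun a => (z a : E)) fun a => h0 _ (z a).2
      simpa using this
    simp [cumBound, h1]
  push Not at h0
  obtain ⟨p, hp, hpp⟩ := h0
  -- The gain of the single point `p` at the worst case `lam = 3`, since `lam ≤ 1 + 2 / T ≤ 3`.
  set c := (1 / 2) * Real.log (1 + k p p / 3) with hcdef
  have hc0 : 0 < c := mul_pos (by norm_num) (Real.log_pos (by linarith))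
  set L := Real.log (((N : ℝ) + 1) / δ) with hL
  have hL0 : 0 ≤ L := Real.log_nonneg (by
    rw [le_div_iff₀ hδ]
    have : (0 : ℝ) ≤ N := Nat.cast_nonneg N
    linarith)
  refine ⟨4 * (B / √c + σ * √(2 * (1 + (1 + L) / c))) * √3, fun T hT lam hlam hlam' => ?_⟩
  have hlam0 : 0 < lam := by linarith
  have hT1 : (1 : ℝ) ≤ T := by exact_mod_cast hT
  have hlam3 : lam ≤ 3 := by
    have : 2 / (T : ℝ) ≤ 2 := div_le_self (by norm_num) hT1
    linarith
  have hγ1 : c ≤ maxInfoGain X k lam 1 := by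
    refine le_trans ?_ (infoGain_le_maxInfoGain hk hlam0 hc (fun _ : Fin 1 => p) fun _ => hp)
    rw [infoGain_succ hk hlam0, infoGain_zero, zero_add]
    have : postCov k lam ((fun _ : Fin 1 => p) ∘ Fin.castSucc) p p = k p p := by
      simp [postCov]
    rw [this]
    refine mul_le_mul_of_nonneg_left (Real.log_le_log (by positivity) ?_) (by norm_num)
    gcongr
  have hmono := maxInfoGain_mono hk hlam0 hc hX
  set γ := maxInfoGain X k lam T with hγ
  have hγc : c ≤ γ := hγ1.trans (hmono hT)
  have hγ0 : 0 < γ := hc0.trans_le hγc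
  have hβ : betaSqrt N X k lam B σ δ T ≤ (B / √c + σ * √(2 * (1 + (1 + L) / c))) * √γ := by
    have h1 : B ≤ B / √c * √γ := by
      rw [div_mul_eq_mul_div, le_div_iff₀ (Real.sqrt_pos.2 hc0)]
      gcongr
    have h2 : √(2 * (maxInfoGain X k lam (T - 1) + 1 + L)) ≤
        √(2 * (1 + (1 + L) / c)) * √γ := by
      rw [← Real.sqrt_mul (by positivity)]
      refine Real.sqrt_le_sqrt ?_
      have h3 := hmono (Nat.sub_le T 1)
      have h4 : 1 + L ≤ (1 + L) / c * γ := by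
        rw [div_mul_eq_mul_div, le_div_iff₀ hc0]
        gcongr
      linarith
    rw [betaSqrt, add_mul, mul_assoc σ]
    gcongr
  have hT3 : √(((T : ℝ) + 2) * γ) ≤ √3 * √T * √γ := by
    rw [← Real.sqrt_mul (by norm_num), ← Real.sqrt_mul (by positivity)]
    refine Real.sqrt_le_sqrt ?_
    gcongr
    linarith
  have hβ0 := betaSqrt_nonneg (X := X) (k := k) (lam := lam) N hB hσ δ T
  calc cumBound N X k lam B σ δ T
      ≤ 4 * ((B / √c + σ * √(2 * (1 + (1 + L) / c))) * √γ) * (√3 * √T * √γ) := by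
        rw [cumBound]; gcongr
    _ = 4 * (B / √c + σ * √(2 * (1 + (1 + L) / c))) * √3 * (√γ * √γ * √T) := by ring
    _ = _ := by rw [Real.mul_self_sqrt hγ0.le]

end Posterior

/-! ### Ville's inequality and Gaussian mixtures of exponential tilts -/

section Ville

open scoped ENNReal

variable {Ω : Type*} {m0 : MeasurableSpace Ω} {μ : Measure Ω}

/-- **Ville's maximal inequality** for a nonnegative supermartingale with finite horizon, in terms
of lower Lebesgue integrals. -/
theorem mul_measure_exists_le_le_lintegral {𝒢 : ℕ → MeasurableSpace Ω} {M : ℕ → Ω → ℝ≥0∞} {K : ℕ}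
    (h𝒢 : ∀ n ≤ K, 𝒢 n ≤ m0) (hmono : ∀ n < K, 𝒢 n ≤ 𝒢 (n + 1))
    (hM : ∀ n ≤ K, Measurable[𝒢 n] (M n))
    (hstep : ∀ n < K, ∀ S, MeasurableSet[𝒢 n] S →
      ∫⁻ ω in S, M (n + 1) ω ∂μ ≤ ∫⁻ ω in S, M n ω ∂μ) (c : ℝ≥0∞) :
    c * μ {ω | ∃ n ≤ K, c ≤ M n ω} ≤ ∫⁻ ω, M 0 ω ∂μ := by
  -- Backward induction on the starting time `n`, localized to an event `S` of the past: where the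
  -- level is reached at `n`, Markov applies; on the rest, the bound from time `n + 1` is pulled
  -- back by `hstep`.
  have key : ∀ j n, n + j = K → ∀ S, MeasurableSet[𝒢 n] S →
      c * μ (S ∩ {ω | ∃ m, n ≤ m ∧ m ≤ K ∧ c ≤ M m ω}) ≤ ∫⁻ ω in S, M n ω ∂μ := by
    have markov : ∀ n ≤ K, ∀ S, MeasurableSet[𝒢 n] S →
        c * μ (S ∩ {ω | c ≤ M n ω}) ≤ ∫⁻ ω in S ∩ {ω | c ≤ M n ω}, M n ω ∂μ := by
      intro n hn S hS
      have hc : MeasurableSet[𝒢 n] {ω | c ≤ M n ω} := hM n hn measurableSet_Ici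
      rw [← setLIntegral_const]
      exact setLIntegral_mono' (h𝒢 n hn _ (hS.inter hc)) fun ω hω => hω.2
    intro j
    induction j with
    | zero =>
      intro n hn S hS
      have h1 : {ω | ∃ m, n ≤ m ∧ m ≤ K ∧ c ≤ M m ω} = {ω | c ≤ M n ω} := by
        ext ω
        constructor
        · rintro ⟨m, h1, h2, h3⟩
          obtain rfl : m = n := by omega
          exact h3
        · exact fun h => ⟨n, le_rfl, by omega, h⟩
      rw [h1]
      exact (markov n (by omega) S hS).trans (lintegral_mono_set Set.inter_subset_left)
    | succ j ih =>
      intro n hn S hS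
      have hc : MeasurableSet[𝒢 n] {ω | c ≤ M n ω} := hM n (by omega) measurableSet_Ici
      have hS' : MeasurableSet[𝒢 n] (S \ {ω | c ≤ M n ω}) := hS.diff hc
      have h1 := ih (n + 1) (by omega) _ (hmono n (by omega) _ hS')
      have h2 := markov n (by omega) S hS
      have h3 : S ∩ {ω | ∃ m, n ≤ m ∧ m ≤ K ∧ c ≤ M m ω} ⊆
          (S ∩ {ω | c ≤ M n ω}) ∪
            ((S \ {ω | c ≤ M n ω}) ∩ {ω | ∃ m, n + 1 ≤ m ∧ m ≤ K ∧ c ≤ M m ω}) := by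
        rintro ω ⟨hω, m, h4, h5, h6⟩
        by_cases h7 : c ≤ M n ω
        · exact Or.inl ⟨hω, h7⟩
        · refine Or.inr ⟨⟨hω, h7⟩, m, ?_, h5, h6⟩
          rcases h4.eq_or_lt with rfl | h8
          · exact absurd h6 h7
          · exact h8
      calc _ ≤ c * (μ (S ∩ {ω | c ≤ M n ω}) + μ ((S \ {ω | c ≤ M n ω}) ∩
              {ω | ∃ m, n + 1 ≤ m ∧ m ≤ K ∧ c ≤ M m ω})) := by
            gcongr
            exact (measure_mono h3).trans (measure_union_le _ _)
        _ ≤ ∫⁻ ω in S ∩ {ω | c ≤ M n ω}, M n ω ∂μ + ∫⁻ ω in S \ {ω | c ≤ M n ω}, M n ω ∂μ := by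
            rw [mul_add]
            exact add_le_add h2 (h1.trans (hstep n (by omega) _ hS'))
        _ = _ := lintegral_inter_add_sdiff _ _ (h𝒢 n (by omega) _ hc)
  have h := key K 0 (by omega) Set.univ MeasurableSet.univ
  simpa using h

/-- Integrating out an independent variable. -/
theorem setLIntegral_preimage_le_of_indepFun {α β : Type*} [MeasurableSpace α] [MeasurableSpace β]
    [IsFiniteMeasure μ] {Z : Ω → α} {W : Ω → β} (hZ : Measurable Z) (hW : Measurable W)
    (hind : IndepFun Z W μ) {F : α × β → ℝ≥0∞} (hF : Measurable F) {G : α → ℝ≥0∞}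
    (hG : Measurable G) (h : ∀ z, ∫⁻ ω, F (z, W ω) ∂μ ≤ G z) {S : Set α} (hS : MeasurableSet S) :
    ∫⁻ ω in Z ⁻¹' S, F (Z ω, W ω) ∂μ ≤ ∫⁻ ω in Z ⁻¹' S, G (Z ω) ∂μ := by
  have h1 : ∫⁻ ω in Z ⁻¹' S, F (Z ω, W ω) ∂μ =
      ∫⁻ q in S ×ˢ Set.univ, F q ∂(μ.map fun ω => (Z ω, W ω)) := by
    rw [setLIntegral_map (hS.prod MeasurableSet.univ) hF (hZ.prodMk hW)]
    congr 2
    ext ω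
    simp
  rw [h1, hind.map_prod_eq_prod_map_map hZ.aemeasurable hW.aemeasurable, ← Measure.prod_restrict,
    Measure.restrict_univ, lintegral_prod _ hF.aemeasurable, ← setLIntegral_map hS hG hZ]
  refine lintegral_mono fun z => ?_
  exact (lintegral_map (hF.comp measurable_prodMk_left) hW).trans_le (h z)

/-- The Gaussian mixture of the exponential martingale increments. -/
theorem lintegral_exp_mul_gaussianPDF (m w : ℝ) {v : ℝ} (hv : 0 ≤ v) :
    ∫⁻ z, ENNReal.ofReal (Real.exp ((m + √v * z) * w - (m + √v * z) ^ 2 / 2)) *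
      gaussianPDF 0 1 z = ENNReal.ofReal
        ((√(1 + v))⁻¹ * Real.exp ((w ^ 2 - (w - m) ^ 2 / (1 + v)) / 2)) := by
  have hv1 : 0 < 1 + v := by linarith
  obtain ⟨s, hs0, hs⟩ : ∃ s : ℝ, 0 ≤ s ∧ s ^ 2 = v := ⟨√v, Real.sqrt_nonneg _, Real.sq_sqrt hv⟩
  have hsv : √v = s := by rw [← hs, Real.sqrt_sq hs0]
  have hq : (1 + v)⁻¹.toNNReal ≠ 0 := by simpa using hv1
  -- Completing the square in `z`: the tilted normal density is a constant times the Gaussian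
  -- density of mean `√v (w - m) / (1 + v)` and variance `1 / (1 + v)`.
  have h : ∀ z, ENNReal.ofReal (Real.exp ((m + √v * z) * w - (m + √v * z) ^ 2 / 2)) *
      gaussianPDF 0 1 z = ENNReal.ofReal
        ((√(1 + v))⁻¹ * Real.exp ((w ^ 2 - (w - m) ^ 2 / (1 + v)) / 2)) *
        gaussianPDF (√v * (w - m) / (1 + v)) (1 + v)⁻¹.toNNReal z := by
    intro z
    rw [gaussianPDF, gaussianPDF, ← ENNReal.ofReal_mul (by positivity),
      ← ENNReal.ofReal_mul (by positivity)]
    congr 1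
    rw [gaussianPDFReal, gaussianPDFReal, Real.coe_toNNReal _ (by positivity), NNReal.coe_one,
      Real.sqrt_mul (by positivity), Real.sqrt_mul (by positivity) (1 + v)⁻¹, Real.sqrt_inv,
      hsv]
    have h1 : (√(1 + v))⁻¹ * Real.exp ((w ^ 2 - (w - m) ^ 2 / (1 + v)) / 2) *
        ((√(2 * Real.pi) * (√(1 + v))⁻¹)⁻¹ *
          Real.exp (-(z - s * (w - m) / (1 + v)) ^ 2 / (2 * (1 + v)⁻¹))) =
        (√(2 * Real.pi))⁻¹ * (Real.exp ((w ^ 2 - (w - m) ^ 2 / (1 + v)) / 2) *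
          Real.exp (-(z - s * (w - m) / (1 + v)) ^ 2 / (2 * (1 + v)⁻¹))) := by
      have : √(1 + v) ≠ 0 := (Real.sqrt_pos.2 hv1).ne'
      field_simp
    rw [h1, mul_left_comm, Real.sqrt_one, mul_one, ← Real.exp_add, ← Real.exp_add]
    congr 2
    field_simp
    rw [← hs]
    ring
  rw [lintegral_congr h, lintegral_const_mul _ (measurable_gaussianPDF _ _),
    lintegral_gaussianPDF_eq_one _ hq, mul_one]

/-- Tonelli: for each fixed tilt `u = m + √v z`, sub-Gaussianity gives `E exp (u W - u² / 2) ≤ 1`,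
and averaging over the Gaussian `z` preserves the bound. -/
theorem lintegral_mixture_le_one [SFinite μ] {W : Ω → ℝ} (hWm : Measurable W)
    (hW : HasSubgaussianMGF W 1 μ) (m : ℝ) {v : ℝ} (hv : 0 ≤ v) :
    ∫⁻ ω, ENNReal.ofReal
      ((√(1 + v))⁻¹ * Real.exp ((W ω ^ 2 - (W ω - m) ^ 2 / (1 + v)) / 2)) ∂μ ≤ 1 := by
  simp_rw [← lintegral_exp_mul_gaussianPDF m _ hv]
  rw [lintegral_lintegral_swap (by
    refine Measurable.aemeasurable ?_
    refine Measurable.mul ?_ ((measurable_gaussianPDF 0 1).comp measurable_snd)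
    fun_prop)]
  rw [← lintegral_gaussianPDF_eq_one 0 (one_ne_zero : (1 : ℝ≥0) ≠ 0)]
  refine lintegral_mono fun z => ?_
  dsimp only
  rw [lintegral_mul_const _ (by fun_prop)]
  refine mul_le_of_le_one_left zero_le ?_
  set u := m + √v * z
  have h1 : ∀ ω, Real.exp (u * W ω - u ^ 2 / 2) = Real.exp (-(u ^ 2 / 2)) * Real.exp (u * W ω) :=
    fun ω => by rw [← Real.exp_add]; ring_nf
  rw [← ofReal_integral_eq_lintegral_ofReal, ← ENNReal.ofReal_one]
  · refine ENNReal.ofReal_le_ofReal ?_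
    simp_rw [h1]
    rw [integral_const_mul]
    have h2 := hW.mgf_le u
    rw [mgf, NNReal.coe_one, one_mul] at h2
    calc _ ≤ Real.exp (-(u ^ 2 / 2)) * Real.exp (u ^ 2 / 2) := by gcongr
      _ = 1 := by rw [← Real.exp_add]; simp
  · simp_rw [h1]
    exact (hW.integrable_exp_mul u).const_mul _
  · exact Filter.Eventually.of_forall fun _ => (Real.exp_pos _).le

end Ville

/-! ### The mixture supermartingale along a run of the algorithm -/

section Mixture

open scoped ENNReal

variable {E : Type*} {k : E → E → ℝ} {lam : ℝ} {n : ℕ}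

/-- The exponential supermartingale of the method of mixtures: the likelihood ratio
`det (1 + lam⁻¹ K) ^ (-1/2) * exp (eᵀ K (K + lam)⁻¹ e / 2)`. -/
noncomputable def mixture {E : Type*} (k : E → E → ℝ) (lam : ℝ) {n : ℕ} (z : Fin n → E)
    (e : Fin n → ℝ) : ℝ≥0∞ :=
  ENNReal.ofReal (Real.exp (selfNormSq k lam z e / 2 - infoGain k lam z))

theorem mixture_succ {F : Type*} [NormedAddCommGroup F] [InnerProductSpace ℝ F] {φ : E → F}
    (hk : ∀ p q, k p q = inner ℝ (φ p) (φ q)) (hlam : 0 < lam)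
    (z : Fin (n + 1) → E) (e : Fin (n + 1) → ℝ) :
    mixture k lam z e = mixture k lam (z ∘ Fin.castSucc) (e ∘ Fin.castSucc) *
      ENNReal.ofReal
        ((√(1 + postCov k lam (z ∘ Fin.castSucc) (z (Fin.last n)) (z (Fin.last n)) / lam))⁻¹ *
        Real.exp ((e (Fin.last n) ^ 2 -
        (e (Fin.last n) - postMean k lam (z ∘ Fin.castSucc) (e ∘ Fin.castSucc)
          (z (Fin.last n))) ^ 2 /
        (1 + postCov k lam (z ∘ Fin.castSucc) (z (Fin.last n)) (z (Fin.last n)) / lam)) / 2)) := by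
  have h0 := postCov_nonneg hk hlam (z ∘ Fin.castSucc) (z (Fin.last n))
  rw [mixture, mixture, ← ENNReal.ofReal_mul (Real.exp_pos _).le, selfNormSq_succ hk hlam,
    infoGain_succ hk hlam]
  congr 1
  set q := 1 + postCov k lam (z ∘ Fin.castSucc) (z (Fin.last n)) (z (Fin.last n)) / lam
  have hq : 0 < q := by positivity
  have h1 : (√q)⁻¹ = Real.exp (-(1 / 2 * Real.log q)) := by
    rw [Real.sqrt_eq_rpow, ← Real.rpow_neg hq.le, Real.rpow_def_of_pos hq]
    ring_nf
  rw [h1, ← Real.exp_add, ← Real.exp_add]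
  ring_nf

variable [MeasurableSpace E]

theorem measurable_gram_entry (hk : Measurable fun p : E × E => k p.1 p.2) (a b : Fin n) :
    Measurable fun z : Fin n → E => gram k z a b :=
  hk.comp (f := fun z : Fin n → E => (z a, z b))
    ((measurable_pi_apply a).prodMk (measurable_pi_apply b))

theorem measurable_det {α : Type*} [MeasurableSpace α] {A : α → Matrix (Fin n) (Fin n) ℝ}
    (hA : ∀ a b, Measurable fun q => A q a b) : Measurable fun q => (A q).det := by
  simp only [Matrix.det_apply]
  refine Finset.measurable_sum _ fun s _ => ?_
  exact (Finset.measurable_prod _ fun i _ => hA _ _).const_smul _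

/-- By Cramer's rule the entries are determinants times the inverse of the determinant; the
convention `0⁻¹ = 0` makes this valid for singular matrices too. -/
theorem measurable_inv_entry {α : Type*} [MeasurableSpace α] {A : α → Matrix (Fin n) (Fin n) ℝ}
    (hA : ∀ a b, Measurable fun q => A q a b) (a b : Fin n) :
    Measurable fun q => (A q)⁻¹ a b := by
  simp only [Matrix.inv_def, Matrix.smul_apply, Ring.inverse_eq_inv', Matrix.adjugate_apply,
    smul_eq_mul]
  refine (measurable_det hA).inv.mul (measurable_det fun c d => ?_)
  by_cases h : c = b
  · subst h
    simp only [Matrix.updateRow_self]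
    exact measurable_const
  · simp only [Matrix.updateRow_ne h]
    exact hA c d

theorem measurable_mixture (hk : Measurable fun p : E × E => k p.1 p.2) (lam : ℝ) (n : ℕ) :
    Measurable fun q : (Fin n → E) × (Fin n → ℝ) => mixture k lam q.1 q.2 := by
  have h1 : ∀ c : ℝ, ∀ a b, Measurable fun q : (Fin n → E) × (Fin n → ℝ) =>
      (gram k q.1 + c • (1 : Matrix (Fin n) (Fin n) ℝ)) a b := fun c a b => by
    simp only [Matrix.add_apply]
    exact ((measurable_gram_entry hk a b).comp measurable_fst).add measurable_const
  have h2 : Measurable fun q : (Fin n → E) × (Fin n → ℝ) => infoGain k lam q.1 := by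
    refine (Real.measurable_log.comp (measurable_det fun a b => ?_)).const_mul _
    simp only [Matrix.add_apply, Matrix.smul_apply]
    exact measurable_const.add
      (Measurable.const_mul ((measurable_gram_entry hk a b).comp measurable_fst) lam⁻¹)
  have h3 : Measurable fun q : (Fin n → E) × (Fin n → ℝ) => selfNormSq k lam q.1 q.2 := by
    have h4 : ∀ a, Measurable fun q : (Fin n → E) × (Fin n → ℝ) => q.2 a :=
      fun a => (measurable_pi_apply a).comp measurable_snd
    unfold selfNormSq
    simp only [dotProduct, Matrix.mulVec]
    refine (Finset.measurable_sum _ fun a _ => (h4 a).mul (h4 a)).sub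
      ((Finset.measurable_sum _ fun a _ => (h4 a).mul
        (Finset.measurable_sum _ fun b _ => ?_)).const_mul _)
    exact (measurable_inv_entry (h1 lam) a b).mul (h4 b)
  exact ENNReal.measurable_ofReal.comp (Real.measurable_exp.comp ((h3.div_const 2).sub h2))

theorem measurable_mixture_comp {α : Type*} [MeasurableSpace α]
    (hk : Measurable fun p : E × E => k p.1 p.2) (lam : ℝ) {u : α → Fin n → E} {v : α → Fin n → ℝ}
    (hu : ∀ a, Measurable fun q => u q a) (hv : ∀ a, Measurable fun q => v q a) :
    Measurable fun q => mixture k lam (u q) (v q) :=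
  (measurable_mixture hk lam n).comp (f := fun q => (u q, v q))
    ((measurable_pi_lambda _ hu).prodMk (measurable_pi_lambda _ hv))

theorem measurable_firstTerms {Ω α : Type*} [MeasurableSpace Ω] [MeasurableSpace α]
    {u : ℕ → Ω → α} {n T : ℕ} (hn : n ≤ T) (hu : ∀ t ∈ Finset.Icc 1 T, Measurable (u t)) :
    Measurable fun ω => firstTerms n fun s => u s ω :=
  measurable_pi_lambda _ fun a => hu _ (by simp; omega)

/-- The self-normalized noise is controlled uniformly over time. -/
theorem IsRun.mul_measure_exists_le_mixture {F Ω : Type*} [NormedAddCommGroup F]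
    [InnerProductSpace ℝ F] {φ : E → F} [MeasurableSpace Ω] {μ : Measure Ω} [IsProbabilityMeasure μ]
    {N : ℕ} {X : Set E} {κ : Fin (N + 1) → E → E → ℝ} {B : Fin (N + 1) → ℝ} {σ : ℝ≥0} {δ : ℝ}
    {g : Fin (N + 1) → E → ℝ} {T : ℕ} {x : ℕ → Ω → E} {ν : Fin (N + 1) → ℕ → Ω → ℝ}
    (h : IsRun μ X κ lam B σ δ g T x ν)
    (hk_meas : Measurable fun p : E × E => k p.1 p.2)
    (hk : ∀ p q, k p q = inner ℝ (φ p) (φ q)) (hlam : 0 < lam) (i : Fin (N + 1)) (c : ℝ≥0∞) :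
    c * μ {ω | ∃ n < T, c ≤ mixture k lam (firstTerms n fun s => x s ω)
      (firstTerms n fun s => (σ : ℝ)⁻¹ * ν i s ω)} ≤ 1 := by
  rcases Nat.eq_zero_or_pos T with rfl | hT
  · simp
  obtain ⟨K, rfl⟩ : ∃ K, T = K + 1 := ⟨T - 1, by omega⟩
  -- The past before the noise of step `n + 1` contains `n` noise vectors but already `n + 1`
  -- points, as `x (n + 1)` is chosen before that noise. The mixture `G n` ignores the last point.
  set Z : (n : ℕ) → Ω → (Fin (n + 1) → E) × (Fin n → Fin (N + 1) → ℝ) := fun n ω =>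
    (firstTerms (n + 1) (fun s => x s ω), firstTerms n (fun s j => ν j s ω)) with hZ
  have hνm : ∀ t ∈ Finset.Icc 1 (K + 1), Measurable fun ω j => ν j t ω :=
    fun t ht => measurable_pi_lambda _ fun j => h.measurable_noise j t ht
  have hZm : ∀ n ≤ K, Measurable (Z n) := fun n hn =>
    (measurable_firstTerms (T := K + 1) (u := x) (by omega) h.measurable_sample).prodMk
      (measurable_firstTerms (T := K + 1) (u := fun t ω j => ν j t ω) (by omega) hνm)
  set G : (n : ℕ) → (Fin (n + 1) → E) × (Fin n → Fin (N + 1) → ℝ) → ℝ≥0∞ := fun n z =>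
    mixture k lam (z.1 ∘ Fin.castSucc) (fun a => (σ : ℝ)⁻¹ * z.2 a i) with hG
  have hGm : ∀ n, Measurable (G n) := fun n => by
    refine measurable_mixture_comp hk_meas lam (fun a => ?_) fun a => ?_
    · exact (measurable_pi_apply a.castSucc).comp measurable_fst
    · fun_prop
  have hv := mul_measure_exists_le_le_lintegral (μ := μ)
    (𝒢 := fun n => MeasurableSpace.comap (Z n) inferInstance)
    (M := fun n ω => G n (Z n ω)) (K := K)
    (fun n hn => (hZm n hn).comap_le) ?_ ?_ ?_ c
  · have h0 : ∀ ω, G 0 (Z 0 ω) = 1 := fun ω => by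
      simp [hG, mixture, selfNormSq, infoGain_zero]
    simp only [h0, lintegral_const, measure_univ, mul_one] at hv
    refine le_trans (mul_le_mul_right (measure_mono ?_) c) hv
    rintro ω ⟨n, hn, hle⟩
    exact ⟨n, Nat.lt_succ_iff.1 hn, hle⟩
  · intro n _
    have h1 : Z n = (fun q : (Fin (n + 2) → E) × (Fin (n + 1) → Fin (N + 1) → ℝ) =>
        ((fun a => q.1 (Fin.castSucc a)), fun a => q.2 (Fin.castSucc a))) ∘ Z (n + 1) := rfl
    have h2 : Measurable (fun q : (Fin (n + 2) → E) × (Fin (n + 1) → Fin (N + 1) → ℝ) =>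
        ((fun a => q.1 (Fin.castSucc a)), fun a => q.2 (Fin.castSucc a)) :
        _ → (Fin (n + 1) → E) × (Fin n → Fin (N + 1) → ℝ)) := by
      refine Measurable.prodMk ?_ ?_
      · exact measurable_pi_lambda _ fun a => (measurable_pi_apply _).comp measurable_fst
      · exact measurable_pi_lambda _ fun a => (measurable_pi_apply _).comp measurable_snd
    rw [h1, ← MeasurableSpace.comap_comp]
    exact MeasurableSpace.comap_mono h2.comap_le
  · exact fun n _ => (hGm n).comp (comap_measurable (Z n))
  · rintro n hn _ ⟨S, hS, rfl⟩
    have hmem : n + 1 ∈ Finset.Icc 1 (K + 1) := by simp; omega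
    -- The next value as a function of the past and the independent new noise, so that the noise can
    -- be integrated with the past frozen.
    set Φ : ((Fin (n + 1) → E) × (Fin n → Fin (N + 1) → ℝ)) × (Fin (N + 1) → ℝ) → ℝ≥0∞ :=
      fun q => mixture k lam q.1.1 (Fin.snoc (α := fun _ => ℝ) (fun a => (σ : ℝ)⁻¹ * q.1.2 a i)
        ((σ : ℝ)⁻¹ * q.2 i)) with hΦ
    have hΦm : Measurable Φ := by
      refine measurable_mixture_comp hk_meas lam
        (fun a => (measurable_pi_apply a).comp (measurable_fst.comp measurable_fst)) fun a => ?_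
      refine Fin.lastCases ?_ (fun b => ?_) a
      · simp only [Fin.snoc_last]
        exact Measurable.const_mul ((measurable_pi_apply i).comp measurable_snd) _
      · simp only [Fin.snoc_castSucc]
        fun_prop
    have h1 : ∀ ω, G (n + 1) (Z (n + 1) ω) = Φ (Z n ω, fun j => ν j (n + 1) ω) := by
      intro ω
      simp only [hΦ, hZ, hG]
      refine congrArg (mixture k lam _) ?_
      funext a
      refine Fin.lastCases ?_ (fun b => ?_) a
      · simp [firstTerms]
      · simp [firstTerms]
    simp only [h1]
    refine setLIntegral_preimage_le_of_indepFun (hZm n hn.le) (hνm _ hmem) (h.indep _ hmem) hΦm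
      (hGm n) (fun z => ?_) hS
    have hsub : HasSubgaussianMGF (fun ω => (σ : ℝ)⁻¹ * ν i (n + 1) ω) 1 μ := by
      have h2 := (h.subgaussian i _ hmem).const_mul (σ : ℝ)⁻¹
      refine ⟨h2.integrable_exp_mul, fun t => (h2.mgf_le t).trans ?_⟩
      rw [Real.exp_le_exp]
      -- For `σ = 0` the convention `0⁻¹ = 0` makes the rescaled noise zero, hence an inequality
      -- instead of an equality.
      have h3 : ((σ : ℝ)⁻¹) ^ 2 * (σ : ℝ) ^ 2 ≤ 1 := by
        rw [← mul_pow]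
        rcases eq_or_ne (σ : ℝ) 0 with h4 | h4
        · simp [h4]
        · rw [inv_mul_cancel₀ h4, one_pow]
      have h5 := mul_le_mul_of_nonneg_right h3 (sq_nonneg t)
      push_cast
      change ((σ : ℝ)⁻¹) ^ 2 * (σ : ℝ) ^ 2 * t ^ 2 / 2 ≤ _
      linarith
    simp only [hΦ, mixture_succ hk hlam, Fin.snoc_last]
    have h6 : ∀ s : ℝ, (Fin.snoc (α := fun _ => ℝ) (fun a => (σ : ℝ)⁻¹ * z.2 a i) s) ∘
        Fin.castSucc = fun a => (σ : ℝ)⁻¹ * z.2 a i := fun s => by funext a; simp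
    simp only [h6]
    have hνi := (h.measurable_noise i _ hmem).const_mul (σ : ℝ)⁻¹
    rw [lintegral_const_mul _ (by fun_prop)]
    exact mul_le_of_le_one_right zero_le (lintegral_mixture_le_one hνi hsub _
      (div_nonneg (postCov_nonneg hk hlam _ _) hlam.le))

end Mixture

/-! ### Feasibility of the optimum, and the probability of the confidence event -/

section Regret

variable {E : Type*} {N : ℕ} {X : Set E} {k : Fin (N + 1) → E → E → ℝ} {lam : ℝ}
  {B : Fin (N + 1) → ℝ} {σ δ : ℝ} {g : Fin (N + 1) → E → ℝ} {T : ℕ} {x : ℕ → E}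
  {y : Fin (N + 1) → ℕ → ℝ} {xstar : E}

/-- If the confidence bands are valid, the optimal point is feasible for all auxiliary problems,
so that every sample solves its auxiliary problem. -/
theorem IsTrajectory.isConstrainedMin (h : IsTrajectory X k lam B σ δ T x y)
    (hxstar : IsConstrainedMin X g xstar)
    (hconf : ∀ i, ∀ t ∈ Finset.Icc 1 T, ∀ p ∈ X, lcbs X k lam B σ δ x y t i p ≤ g i p)
    {t : ℕ} (ht : t ∈ Finset.Icc 1 T) :
    xstar ∈ feasibleSet X (lcbs X k lam B σ δ x y t) ∧
      IsConstrainedMin X (lcbs X k lam B σ δ x y t) (x t) := by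
  have hfeas : ∀ s ∈ Finset.Icc 1 T, xstar ∈ feasibleSet X (lcbs X k lam B σ δ x y s) :=
    fun s hs => ⟨hxstar.1.1, fun i => (hconf _ s hs _ hxstar.1.1).trans (hxstar.1.2 i)⟩
  exact ⟨hfeas t ht, (h t ht).2 fun s hs =>
    ⟨xstar, hfeas s (Finset.Icc_subset_Icc_right (Finset.mem_Icc.1 ht).2 hs)⟩⟩

theorem not_declaresInfeasible_of_mem {l : Fin (N + 1) → E → ℝ} {p : E}
    (hp : p ∈ feasibleSet X l) : ¬ DeclaresInfeasible X l := by
  rintro ⟨i, hi⟩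
  exact absurd (hi p hp.1) (not_lt.2 (hp.2 i))

end Regret

/-- All confidence bands are valid at all steps with probability at least `1 - δ`. -/
theorem IsRun.exists_confidence {E Ω : Type*} [MeasurableSpace E] [MeasurableSpace Ω]
    {μ : Measure Ω} [IsProbabilityMeasure μ] {N : ℕ} {X : Set E} {k : Fin (N + 1) → E → E → ℝ}
    {lam : ℝ} {B : Fin (N + 1) → ℝ} {σ : ℝ≥0} {δ : ℝ} {T : ℕ} {x : ℕ → Ω → E}
    {ν : Fin (N + 1) → ℕ → Ω → ℝ} {H : Fin (N + 1) → Type*} [∀ i, NormedAddCommGroup (H i)]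
    [∀ i, InnerProductSpace ℝ (H i)] {φ : ∀ i, E → H i} (g : ∀ i, H i)
    (h : IsRun μ X k lam B σ δ (fun i p => inner ℝ (φ i p) (g i)) T x ν)
    (hk_meas : ∀ i, Measurable fun p : E × E => k i p.1 p.2)
    (hk : ∀ i p q, k i p q = inner ℝ (φ i p) (φ i q)) (hc : ∀ i, ∀ p ∈ X, k i p p ≤ 1)
    (hB : ∀ i, ‖g i‖ ≤ B i) (hlam : 1 ≤ lam) (hδ : 0 < δ) :
    ∃ A : Set Ω, MeasurableSet A ∧ ENNReal.ofReal (1 - δ) ≤ μ A ∧ ∀ ω ∈ A,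
      ∀ i, ∀ t ∈ Finset.Icc 1 T, ∀ p,
        |inner ℝ (φ i p) (g i) - postMean (k i) lam (firstTerms (t - 1) fun s => x s ω)
          (firstTerms (t - 1) fun s => inner ℝ (φ i (x s ω)) (g i) + ν i s ω) p| ≤
        betaSqrt N X (k i) lam (B i) σ δ t *
          postStd (k i) lam (firstTerms (t - 1) fun s => x s ω) p := by
  have hlam0 : 0 < lam := by linarith
  set M : Fin (N + 1) → ℕ → Ω → ENNReal := fun i n ω =>
    mixture (k i) lam (firstTerms n fun s => x s ω) (firstTerms n fun s => (σ : ℝ)⁻¹ * ν i s ω)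
    with hM
  have hc0 : 0 < ((N : ℝ) + 1) / δ := by positivity
  set c : ENNReal := ENNReal.ofReal (((N : ℝ) + 1) / δ) with hcdef
  have hMm : ∀ i, ∀ n < T, Measurable (M i n) := fun i n hn => by
    refine measurable_mixture_comp (hk_meas i) lam (fun a => ?_) fun a => ?_
    · exact h.measurable_sample _ (by simp; omega)
    · exact (h.measurable_noise i _ (by simp; omega)).const_mul _
  set U : Fin (N + 1) → Set Ω := fun i => {ω | ∃ n < T, c ≤ M i n ω} with hU
  have hUm : ∀ i, MeasurableSet (U i) := fun i => by
    have : U i = ⋃ n ∈ Set.Iio T, {ω | c ≤ M i n ω} := by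
      ext ω; simp [hU]
    rw [this]
    exact MeasurableSet.biUnion (Set.to_countable _)
      fun n hn => measurableSet_le measurable_const (hMm i n hn)
  have hUμ : ∀ i, μ (U i) ≤ ENNReal.ofReal (δ / (N + 1)) := fun i => by
    have h1 := h.mul_measure_exists_le_mixture (hk_meas i) (hk i) hlam0 i c
    have h2 : μ (U i) ≤ 1 / c := by
      rw [ENNReal.le_div_iff_mul_le (Or.inl (by simp [hc0]))
        (Or.inl ENNReal.ofReal_ne_top), mul_comm]
      exact h1
    refine h2.trans_eq ?_
    rw [one_div, hcdef, ← ENNReal.ofReal_inv_of_pos hc0, inv_div]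
  -- Undoing the rescaling by `σ⁻¹` is an identity for `σ ≠ 0`. For `σ = 0` it says that the noise
  -- vanishes, which holds only almost surely.
  set V : Set Ω := {ω | ∀ i, ∀ t ∈ Finset.Icc 1 T, ν i t ω = σ * ((σ : ℝ)⁻¹ * ν i t ω)} with hV
  have hVm : MeasurableSet V := by
    have : V = ⋂ i, ⋂ t ∈ Finset.Icc 1 T, {ω | ν i t ω = σ * ((σ : ℝ)⁻¹ * ν i t ω)} := by
      ext ω; simp only [hV, Set.mem_iInter, Set.mem_ofPred_eq]
    rw [this]
    refine MeasurableSet.iInter fun i => Finset.measurableSet_biInter _ fun t ht => ?_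
    have h1 := h.measurable_noise i t ht
    exact measurableSet_eq_fun h1 ((h1.const_mul _).const_mul _)
  have hVμ : ∀ᵐ ω ∂μ, ω ∈ V := by
    refine ae_all_iff.2 fun i => (Finset.eventually_all _).2 fun t ht => ?_
    rcases eq_or_ne σ 0 with h0 | h0
    · have h1 := h.subgaussian i t ht
      rw [h0, zero_pow two_ne_zero] at h1
      filter_upwards [h1.ae_eq_zero_of_hasSubgaussianMGF_zero] with ω hω
      simp [hω]
    · refine Filter.Eventually.of_forall fun ω => ?_
      have : (σ : ℝ) ≠ 0 := by exact_mod_cast h0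
      field_simp
  refine ⟨(⋃ i, U i)ᶜ ∩ V, (MeasurableSet.iUnion hUm).compl.inter hVm, ?_, ?_⟩
  · rw [measure_inter_conull (ae_iff.1 hVμ), prob_compl_eq_one_sub (MeasurableSet.iUnion hUm),
      ENNReal.ofReal_sub _ hδ.le, ENNReal.ofReal_one]
    refine tsub_le_tsub_left ?_ _
    calc μ (⋃ i, U i) ≤ ∑ i, μ (U i) := measure_iUnion_fintype_le _ _
      _ ≤ ∑ _i : Fin (N + 1), ENNReal.ofReal (δ / (N + 1)) := Finset.sum_le_sum fun i _ => hUμ i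
      _ = ENNReal.ofReal δ := by
        rw [← ENNReal.ofReal_sum_of_nonneg fun _ _ => by positivity]
        congr 1
        simp
        field_simp
  · rintro ω ⟨hωU, hωV⟩ i t ht p
    have ht' := Finset.mem_Icc.1 ht
    have h1 : M i (t - 1) ω < c := by
      simp only [hU, Set.mem_compl_iff, Set.mem_iUnion, Set.mem_ofPred_eq, not_exists, not_and,
        not_le] at hωU
      exact hωU i (t - 1) (by omega)
    have h2 := (ENNReal.ofReal_lt_ofReal_iff hc0).1 h1
    refine abs_sub_postMean_le_of_selfNormSq_le (hk i) hlam _ p (g i) (hB i) σ.coe_nonneg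
      (e := firstTerms (t - 1) fun s => (σ : ℝ)⁻¹ * ν i s ω) (fun a => ?_)
      ((Real.lt_log_iff_exp_lt hc0).2 h2).le ?_
    · simp only [firstTerms]
      exact congrArg _ (hωV i (a + 1) (by simp; omega))
    · exact infoGain_le_maxInfoGain (hk i) hlam0 (hc i) _
        fun a => (h.trajectory ω (a + 1) (by simp; omega)).1

end Config

/-! ### The main theorem: optimism on the confidence event -/

theorem theorem1 {d N : ℕ}
    (X : Set (EuclideanSpace ℝ (Fin d))) (hX : IsCompact X)
    (k : Fin (N + 1) → EuclideanSpace ℝ (Fin d) → EuclideanSpace ℝ (Fin d) → ℝ)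
    (hk_meas : ∀ i, Measurable
      fun p : EuclideanSpace ℝ (Fin d) × EuclideanSpace ℝ (Fin d) => k i p.1 p.2)
    (hk_le : ∀ i, ∀ p ∈ X, k i p p ≤ 1)
    -- `H i` is the reproducing kernel Hilbert space with kernel `k i`
    (H : Fin (N + 1) → Type*) [∀ i, NormedAddCommGroup (H i)]
    [∀ i, InnerProductSpace ℝ (H i)] [∀ i, CompleteSpace (H i)]
    [∀ i, RKHS ℝ (H i) (EuclideanSpace ℝ (Fin d)) ℝ]
    (hk : ∀ i p q, RKHS.kernel (H i) p q 1 = k i p q)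
    -- `g 0` is the objective, the other `g i` are the constraint functions
    (g : ∀ i, H i) (B : Fin (N + 1) → ℝ) (hB : ∀ i, ‖g i‖ ≤ B i)
    (xstar : EuclideanSpace ℝ (Fin d))
    (hxstar : Config.IsConstrainedMin X (fun i => ⇑(g i)) xstar)
    (σ : ℝ≥0) (δ : ℝ) (hδ : 0 < δ) (hδ' : δ < 1) :
    -- the bounds, with probability at least `1 - δ`
    (∀ (T : ℕ) (_ : 1 ≤ T) (lam : ℝ) (_ : 1 ≤ lam) (_ : lam ≤ 1 + 2 / (T : ℝ))
      (Ω : Type*) [MeasurableSpace Ω] (μ : Measure Ω) [IsProbabilityMeasure μ]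
      (x : ℕ → Ω → EuclideanSpace ℝ (Fin d)) (ν : Fin (N + 1) → ℕ → Ω → ℝ)
      (_ : Config.IsRun μ X k lam B σ δ (fun i => ⇑(g i)) T x ν),
      ∃ A : Set Ω, MeasurableSet A ∧ ENNReal.ofReal (1 - δ) ≤ μ A ∧ ∀ ω ∈ A,
        -- infeasibility is never declared, and every sample solves its auxiliary problem
        (∀ t ∈ Finset.Icc 1 T,
          ¬ Config.DeclaresInfeasible X
            (Config.lcbs X k lam B σ δ (fun s => x s ω)
              (fun i s => g i (x s ω) + ν i s ω) t) ∧
          Config.IsConstrainedMin X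
            (Config.lcbs X k lam B σ δ (fun s => x s ω)
              (fun i s => g i (x s ω) + ν i s ω) t) (x t ω)) ∧
        -- regret and violation bounds, simultaneously at all times up to the horizon
        ∀ t ∈ Finset.Icc 1 T,
          Config.cumRegret (g 0) (g 0 xstar) (fun s => x s ω) t
            ≤ Config.cumPosRegret (g 0) (g 0 xstar) (fun s => x s ω) t ∧
          Config.cumPosRegret (g 0) (g 0 xstar) (fun s => x s ω) t
            ≤ Config.cumBound N X (k 0) lam (B 0) σ δ t ∧
          ∀ i : Fin N, Config.cumViolation (g i.succ) (fun s => x s ω) t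
            ≤ Config.cumBound N X (k i.succ) lam (B i.succ) σ δ t) ∧
    -- all the bounds are of order `γ_T √T`
    (∀ i, ∃ C : ℝ, ∀ T : ℕ, 1 ≤ T → ∀ lam : ℝ, 1 ≤ lam → lam ≤ 1 + 2 / (T : ℝ) →
      Config.cumBound N X (k i) lam (B i) σ δ T
        ≤ C * (Config.maxInfoGain X (k i) lam T * √(T : ℝ))) := by

  -- The canonical feature map `p ↦ k(p, ·)` of the RKHS; `hg` is the reproducing property.
  have hk' : ∀ i p q, k i p q =
      inner ℝ (RKHS.kerFun (H i) p (1 : ℝ)) (RKHS.kerFun (H i) q (1 : ℝ)) := fun i p q => by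
    rw [← hk, RKHS.kerFun_inner, RKHS.kerFun_apply]
    simp
  have hg : ∀ i p, g i p = inner ℝ (RKHS.kerFun (H i) p (1 : ℝ)) (g i) := fun i p => by
    rw [RKHS.kerFun_inner]
    simp
  have hB0 : ∀ i, 0 ≤ B i := fun i => (norm_nonneg _).trans (hB i)
  have hXne : X.Nonempty := ⟨xstar, hxstar.1.1⟩
  refine ⟨?_, fun i => Config.exists_cumBound_le (hk' i) (hk_le i) hXne N (hB0 i) σ.coe_nonneg hδ hδ'⟩
  intro T hT lam hlam hlam' Ω _ μ _ x ν hrun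
  have hlamt : ∀ t ∈ Finset.Icc 1 T, lam * t ≤ t + 2 := fun t ht => by
    obtain ⟨ht1, ht2⟩ := Finset.mem_Icc.1 ht
    have hT0 : (0 : ℝ) < T := by exact_mod_cast hT
    have ht3 : (t : ℝ) ≤ T := by exact_mod_cast ht2
    calc lam * t ≤ (1 + 2 / (T : ℝ)) * t := by gcongr
      _ = t + 2 * (t / T) := by ring
      _ ≤ t + 2 * 1 := by gcongr; exact (div_le_one hT0).2 ht3
      _ = t + 2 := by ring
  have hg' : (fun i => ⇑(g i)) = fun i p => inner ℝ (RKHS.kerFun (H i) p (1 : ℝ)) (g i) := by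
    funext i p
    exact hg i p
  obtain ⟨A, hAm, hAμ, hA⟩ := Config.IsRun.exists_confidence g (hg' ▸ hrun) hk_meas hk' hk_le hB
    hlam hδ
  refine ⟨A, hAm, hAμ, fun ω hω => ?_⟩
  have hband := hA ω hω
  simp only [← hg] at hband
  have htraj := hrun.trajectory ω
  have hlower : ∀ i, ∀ t ∈ Finset.Icc 1 T, ∀ p ∈ X,
      Config.lcbs X k lam B σ δ (fun s => x s ω) (fun i s => g i (x s ω) + ν i s ω) t i p ≤
        g i p := fun i t ht p _ => by
    have := (abs_le.1 (hband i t ht p)).1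
    simp only [Config.lcbs, Config.lcb]
    linarith
  have hupper : ∀ i, ∀ t ∈ Finset.Icc 1 T, ∀ p, g i p ≤
      Config.lcbs X k lam B σ δ (fun s => x s ω) (fun i s => g i (x s ω) + ν i s ω) t i p +
        2 * (Config.betaSqrt N X (k i) lam (B i) σ δ t *
          Config.postStd (k i) lam (Config.firstTerms (t - 1) fun s => x s ω) p) :=
    fun i t ht p => by
      have := (abs_le.1 (hband i t ht p)).2
      simp only [Config.lcbs, Config.lcb]
      linarith
  have hmin := fun t (ht : t ∈ Finset.Icc 1 T) => htraj.isConstrainedMin hxstar hlower ht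
  -- Nonnegativity of the widths lets them bound positive parts.
  have hwidth : ∀ i t, 0 ≤ 2 * (Config.betaSqrt N X (k i) lam (B i) σ δ t *
      Config.postStd (k i) lam (Config.firstTerms (t - 1) fun s => x s ω) (x t ω)) := fun i t =>
    mul_nonneg zero_le_two
      (mul_nonneg (Config.betaSqrt_nonneg N (hB0 i) σ.coe_nonneg δ t) (Config.postStd_nonneg _ _))
  refine ⟨fun t ht => ⟨Config.not_declaresInfeasible_of_mem (hmin t ht).1, (hmin t ht).2⟩,
    fun t ht => ?_⟩
  have hsub : ∀ s ∈ Finset.Icc 1 t, s ∈ Finset.Icc 1 T := fun s hs =>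
    Finset.Icc_subset_Icc_right (Finset.mem_Icc.1 ht).2 hs
  have hsum := fun i => Config.sum_width_le (hk' i) hlam (hk_le i) hXne N (hB0 i) σ.coe_nonneg δ
    (fun s => x s ω) (fun s hs => (htraj s (hsub s hs)).1) (hlamt t ht)
  refine ⟨Finset.sum_le_sum fun s _ => le_max_left _ _, ?_, fun i => ?_⟩
  · refine (Finset.sum_le_sum fun s hs => max_le ?_ (hwidth 0 s)).trans (hsum 0)
    -- Optimism: `f (x s) ≤ l₀ (x s) + width ≤ l₀ xstar + width ≤ f xstar + width`, the middle
    -- inequality because `xstar` competes in the auxiliary problem.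
    have h1 := hupper 0 s (hsub s hs) (x s ω)
    have h2 := (hmin s (hsub s hs)).2.2 xstar (hmin s (hsub s hs)).1
    have h3 := hlower 0 s (hsub s hs) xstar hxstar.1.1
    linarith
  · refine (Finset.sum_le_sum fun s hs => max_le ?_ (hwidth i.succ s)).trans (hsum i.succ)
    have h1 := hupper i.succ s (hsub s hs) (x s ω)
    have h2 := (hmin s (hsub s hs)).2.1.2 i
    linarith
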